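/- Let $F$ be a field, $K=F(q)$ the field of rational functions in $q$, $n\ge 0$, and $\mathfrak{Pol}=K[x_1,\dots,x_n]$. Operators on $\mathfrak{Pol}$ are written on the right of their argument and composed from left to right. For $1\le i\le n-1$ let $s_i$ be the transposition exchanging $x_i$ and $x_{i+1}$, and put $$f\,\partial_i=\frac{f-f^{s_i}}{x_i-x_{i+1}},\qquad f\,\square_i=\bigl(f\,(x_i-qx_{i+1})\bigr)\partial_i,\qquad T_i=\square_i-1 .$$ Write permutations as words $\sigma=\sigma_1\cdots\sigma_n$; they act on the right of vectors by $(v\sigma)_i=v_{\sigma_i}$, $\ell$ is the number of inversions and $\omega$ is the permutation of maximal length. For $\mathbf u=(u_1,\dots,u_n)$ the Yang–Baxter elements $Y^{\mathbf u}_\sigma$, $\sigma\in\mathfrak S_n$, acting on $\mathfrak{Pol}$, are defined recursively by $Y^{\mathbf u}_{id}=1$ and $$Y^{\mathbf u}_{\sigma s_i}=Y^{\mathbf u}_\sigma\Bigl(T_i+\frac{1-q}{1-u_{\sigma_{i+1}}/u_{\sigma_i}}\Bigr)\quad\text{when } \ell(\sigma s_i)>\ell(\sigma).\tag{1}$$ Let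 $Y_\sigma=Y^{\mathbf u}_\sigma$ for $\mathbf u=(1,q,\dots,q^{n-1})$ and $\widehat Y_\sigma=Y^{\mathbf u}_\sigma$ for $\mathbf u=(q^{n-1},\dots,q,1)$. For $v\in\mathbb N^n$ let $\lambda$ be its weakly decreasing reordering, let $\zeta(v)$ (resp. $\eta(v)$) be the permutation of maximal (resp. minimal) length with $\lambda\,\zeta(v)=v$ (resp. $\lambda\,\eta(v)=v$), and let $d_\lambda(q)=\prod_{a\ge0}\prod_{j=1}^{m_a}\frac{1-q^j}{1-q}$, where $m_a$ is the number of entries of $\lambda$ equal to $a$. The $q$-Key polynomials are $$U_v=\Bigl(\frac1{d_\lambda(q)}\,x^\lambda\Bigr)Y_{\zeta(v)},\qquad \widehat U_v=x^\lambda\,\widehat Y_{\eta(v)} .$$ Define a bilinear form on $\mathfrak{Pol}$ by $$(f,g)_q=CT\Bigl(f\,g^\clubsuit\prod_{1\le i<j\le n}\frac{1-x_i/x_j}{1-q\,x_i/x_j}\Bigr),$$ where $g^\clubsuit$ is obtained from $g$ by substituting $1/x_{n+1-i}$ for $x_i$, each $1/(1-qx_i/x_j)$ with $i<j$ is expanded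 as a geometric series in $x_i/x_j$, and $CT$ is the constant term. Theorem. The recursion (1) is consistent for both choices of $\mathbf u$, and $(U_v)_{v\in\mathbb N^n}$ and $(\widehat U_v)_{v\in\mathbb N^n}$ are two bases of $\mathfrak{Pol}$ over $K$ that are adjoint with respect to $(\ ,\ )_q$: for all $u,v\in\mathbb N^n$, $$(U_v,\widehat U_{u\omega})_q=\delta_{v,u},\qquad u\omega=(u_n,\dots,u_1).$$ As a consequence, the Hall–Littlewood polynomials form the basis dual to the dominant monomials: for weakly decreasing $\lambda\in\mathbb N^n$, the rational functions $$P_\lambda(x;q)=\frac1{d_\lambda(q)}\sum_{w\in\mathfrak S_n}w\Bigl(x^\lambda\prod_{1\le i<j\le n}\frac{x_i-qx_j}{x_i-x_j}\Bigr)$$ are polynomials, they form a $K$-basis of the space of symmetric polynomials in $x_1,\dots,x_n$, and $(P_\lambda,x^\mu)_q=\delta_{\lambda,\mu}$ for all weakly decreasing $\lambda,\mu\in\mathbb N^n$. -/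

import Mathlib

open MvPolynomial

namespace QKey

noncomputable section

/-! ### Permutations of `{1, …, n}`, written in one-line notation

A permutation `σ` stands for the word `σ 0, …, σ (n-1)`. It acts on the right of a weight `v` by
`v σ = v ∘ σ`, and `σ s_i = σ * simple i` exchanges the entries in the positions `i`, `i+1`. -/

/-- The left one of the two adjacent positions exchanged by the `i`-th simple transposition. -/
def lo {n : ℕ} (i : Fin (n - 1)) : Fin n := ⟨i.1, by have := i.2; omega⟩

/-- The right one of the two adjacent positions exchanged by the `i`-th simple transposition. -/
def hi {n : ℕ} (i : Fin (n - 1)) : Fin n := ⟨i.1 + 1, by have := i.2; omega⟩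

theorem lo_lt_hi {n : ℕ} (i : Fin (n - 1)) : lo i < hi i := by
  simp [lo, hi, Fin.lt_def]

/-- The `i`-th simple transposition. -/
def simple {n : ℕ} (i : Fin (n - 1)) : Equiv.Perm (Fin n) := Equiv.swap (lo i) (hi i)

/-- The set of inversions of a permutation. -/
def inversions {n : ℕ} (σ : Equiv.Perm (Fin n)) : Finset (Fin n × Fin n) :=
  Finset.univ.filter fun p => p.1 < p.2 ∧ σ p.2 < σ p.1

/-- The length of a permutation. -/
def length {n : ℕ} (σ : Equiv.Perm (Fin n)) : ℕ := (inversions σ).card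

theorem simple_lt_simple {n : ℕ} (i : Fin (n - 1)) {a b : Fin n} (hab : a < b)
    (hne : ¬ (a = lo i ∧ b = hi i)) : simple i a < simple i b := by
  have h1 : (lo i).1 = i.1 := rfl
  have h2 : (hi i).1 = i.1 + 1 := rfl
  simp only [Fin.ext_iff] at hne
  rw [Fin.lt_def] at hab
  unfold simple
  rw [Equiv.swap_apply_def, Equiv.swap_apply_def]
  simp only [Fin.ext_iff, Fin.lt_def]
  split_ifs <;> omega

theorem length_mul_simple_lt {n : ℕ} (σ : Equiv.Perm (Fin n)) (i : Fin (n - 1))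
    (h : σ (hi i) < σ (lo i)) : length (σ * simple i) < length σ := by
  classical
  have hs : ∀ a, simple i (simple i a) = a := fun a => by
    simp only [simple, Equiv.swap_apply_def]
    split_ifs <;> simp_all
  unfold length
  rw [← Finset.card_image_of_injective (inversions (σ * simple i))
    (f := fun p : Fin n × Fin n => (simple i p.1, simple i p.2))
    (fun p r hpr => by
      have h1 := congrArg Prod.fst hpr
      have h2 := congrArg Prod.snd hpr
      exact Prod.ext ((simple i).injective h1) ((simple i).injective h2))]
  have hlo : simple i (lo i) = hi i := Equiv.swap_apply_left _ _
  have hhi : simple i (hi i) = lo i := Equiv.swap_apply_right _ _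
  apply Finset.card_lt_card
  rw [Finset.ssubset_iff_of_subset]
  · refine ⟨(lo i, hi i), by simp [inversions, lo_lt_hi, h], ?_⟩
    intro hm
    obtain ⟨p, hp, hpe⟩ := Finset.mem_image.1 hm
    have h1 : p.1 = hi i := by
      rw [← hs p.1, show simple i p.1 = lo i from congrArg Prod.fst hpe, hlo]
    have h2 : p.2 = lo i := by
      rw [← hs p.2, show simple i p.2 = hi i from congrArg Prod.snd hpe, hhi]
    have h3 := (Finset.mem_filter.1 hp).2.1
    rw [h1, h2] at h3
    exact absurd h3 (lo_lt_hi i).le.not_gt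
  · intro r hr
    obtain ⟨p, hp, rfl⟩ := Finset.mem_image.1 hr
    obtain ⟨h1, h2⟩ := (Finset.mem_filter.1 hp).2
    refine Finset.mem_filter.2 ⟨Finset.mem_univ _, ?_, h2⟩
    refine simple_lt_simple i h1 ?_
    rintro ⟨e1, e2⟩
    rw [e1, e2, Equiv.Perm.mul_apply, Equiv.Perm.mul_apply, hlo, hhi] at h2
    exact absurd h2 h.le.not_gt

/-! ### Operators on polynomials -/

theorem X_sub_X_dvd {K : Type*} [Field K] {n : ℕ} (i : Fin (n - 1))
    (f : MvPolynomial (Fin n) K) :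
    (X (lo i) - X (hi i) : MvPolynomial (Fin n) K) ∣ f - rename (simple i) f := by
  induction f using MvPolynomial.induction_on with
  | C a => simp
  | add p r hp hr =>
    have : p + r - rename (simple i) (p + r)
        = (p - rename (simple i) p) + (r - rename (simple i) r) := by
      rw [map_add]; ring
    rw [this]
    exact dvd_add hp hr
  | mul_X p k hp =>
    have hk : (X (lo i) - X (hi i) : MvPolynomial (Fin n) K) ∣ X k - X (simple i k) := by
      unfold simple
      rw [Equiv.swap_apply_def]
      split_ifs with h1 h2
      · rw [h1]
      · rw [h2, ← neg_sub (X (lo i)) (X (hi i)), dvd_neg]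
      · simp
    have : p * X k - rename (simple i) (p * X k)
        = (p - rename (simple i) p) * X k
          + rename (simple i) p * (X k - X (simple i k)) := by
      rw [map_mul, rename_X]; ring
    rw [this]
    exact dvd_add (hp.mul_right _) (hk.mul_left _)

theorem X_sub_X_ne_zero {K : Type*} [Field K] {n : ℕ} (i : Fin (n - 1)) :
    (X (lo i) - X (hi i) : MvPolynomial (Fin n) K) ≠ 0 := fun h =>
  (lo_lt_hi i).ne (X_injective (sub_eq_zero.1 h))

/-- The value `f ∂_i = (f - f^{s_i}) / (x_i - x_{i+1})` of the divided difference. -/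
def divDiffFun {K : Type*} [Field K] {n : ℕ} (i : Fin (n - 1))
    (f : MvPolynomial (Fin n) K) : MvPolynomial (Fin n) K :=
  (X_sub_X_dvd i f).choose

theorem mul_divDiffFun {K : Type*} [Field K] {n : ℕ} (i : Fin (n - 1))
    (f : MvPolynomial (Fin n) K) :
    (X (lo i) - X (hi i)) * divDiffFun i f = f - rename (simple i) f :=
  (X_sub_X_dvd i f).choose_spec.symm

/-- The divided difference `∂_i` as a linear operator. -/
def divDiff (K : Type*) [Field K] {n : ℕ} (i : Fin (n - 1)) :
    Module.End K (MvPolynomial (Fin n) K) where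
  toFun := divDiffFun i
  map_add' f g := by
    apply mul_left_cancel₀ (X_sub_X_ne_zero (K := K) i)
    rw [mul_add, mul_divDiffFun, mul_divDiffFun, mul_divDiffFun, map_add]
    ring
  map_smul' c f := by
    apply mul_left_cancel₀ (X_sub_X_ne_zero (K := K) i)
    rw [RingHom.id_apply, mul_smul_comm, mul_divDiffFun, mul_divDiffFun, map_smul, smul_sub]

/-- The operator `□_i = (x_i - q x_{i+1}) ∂_i`. Operators are written on the right of their
argument, so a polynomial is first multiplied by `x_i - q x_{i+1}`. -/
def square {K : Type*} [Field K] (q : K) {n : ℕ} (i : Fin (n - 1)) :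
    Module.End K (MvPolynomial (Fin n) K) :=
  divDiff K i * LinearMap.mulLeft K (X (lo i) - C q * X (hi i))

/-- The action `T_i = □_i - 1` on polynomials of the generators of the Hecke algebra. -/
def heckeT {K : Type*} [Field K] (q : K) {n : ℕ} (i : Fin (n - 1)) :
    Module.End K (MvPolynomial (Fin n) K) :=
  square q i - 1

/-! ### Yang-Baxter elements -/

/-- The recursion that defines the Yang-Baxter elements `Y_σ` with spectral parameters `u`, for
the action on polynomials: `Y_id = 1` and
`Y_{σ s_i} = Y_σ (T_i + (1 - q) / (1 - u_{σ_{i+1}} / u_{σ_i}))` if `ℓ(σ s_i) > ℓ(σ)`, that is, if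
`σ_i < σ_{i+1}`. A product of operators that are written on the right applies its left factor
first. -/
structure IsYangBaxter {K : Type*} [Field K] (q : K) {n : ℕ} (u : Fin n → K)
    (Y : Equiv.Perm (Fin n) → Module.End K (MvPolynomial (Fin n) K)) : Prop where
  one : Y 1 = 1
  step : ∀ (σ : Equiv.Perm (Fin n)) (i : Fin (n - 1)), σ (lo i) < σ (hi i) →
    Y (σ * simple i) =
      (heckeT q i + ((1 - q) / (1 - u (σ (hi i)) / u (σ (lo i)))) • 1) * Y σ

open Classical in
/-- The Yang-Baxter elements acting on polynomials, computed by the recursion of `IsYangBaxter`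
along some descent `i` of `σ`, that is, from `Y_{σ s_i}` for some `i` with `ℓ(σ s_i) < ℓ(σ)`. -/
def yangBaxter {K : Type*} [Field K] (q : K) {n : ℕ} (u : Fin n → K)
    (σ : Equiv.Perm (Fin n)) : Module.End K (MvPolynomial (Fin n) K) :=
  if h : ∃ i : Fin (n - 1), σ (hi i) < σ (lo i) then
    (heckeT q h.choose
      + ((1 - q) / (1 - u (σ (lo h.choose)) / u (σ (hi h.choose)))) • 1)
      * yangBaxter q u (σ * simple h.choose)
  else 1
termination_by length σ
decreasing_by exact length_mul_simple_lt σ _ h.choose_spec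

/-- The spectral parameters `(1, q, …, q^{n-1})`. -/
def params {K : Type*} [Field K] (q : K) (n : ℕ) : Fin n → K := fun i => q ^ (i : ℕ)

/-- The reversed spectral parameters `(q^{n-1}, …, q, 1)`. -/
def paramsRev {K : Type*} [Field K] (q : K) (n : ℕ) : Fin n → K :=
  fun i => q ^ (Fin.rev i : ℕ)

/-! ### `q`-Key polynomials -/

/-- The reordering of a weight in weakly decreasing order. -/
def dominant {n : ℕ} (v : Fin n → ℕ) : Fin n → ℕ := v ∘ Tuple.sort v ∘ Fin.rev

theorem dominant_antitone {n : ℕ} (v : Fin n → ℕ) : Antitone (dominant v) :=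
  fun _ _ h => Tuple.monotone_sort v (Fin.rev_le_rev.2 h)

/-- The permutations `σ` with `λ σ = v`, where `λ` is the dominant reordering of `v`. -/
def sorters {n : ℕ} (v : Fin n → ℕ) : Finset (Equiv.Perm (Fin n)) :=
  Finset.univ.filter fun σ => dominant v ∘ σ = v

theorem sorters_nonempty {n : ℕ} (v : Fin n → ℕ) : (sorters v).Nonempty := by
  refine ⟨(Tuple.sort v)⁻¹.trans Fin.revPerm, ?_⟩
  refine Finset.mem_filter.2 ⟨Finset.mem_univ _, ?_⟩
  funext j
  simp [dominant]

/-- `ζ(v)`: the permutation of maximal length with `λ ζ(v) = v`. -/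
def zeta {n : ℕ} (v : Fin n → ℕ) : Equiv.Perm (Fin n) :=
  (Finset.exists_max_image (sorters v) length (sorters_nonempty v)).choose

/-- `η(v)`: the permutation of minimal length with `λ η(v) = v`. -/
def eta {n : ℕ} (v : Fin n → ℕ) : Equiv.Perm (Fin n) :=
  (Finset.exists_min_image (sorters v) length (sorters_nonempty v)).choose

/-- The monomial `x^v`. -/
def mono (K : Type*) [Field K] {n : ℕ} (v : Fin n → ℕ) : MvPolynomial (Fin n) K :=
  ∏ i, X i ^ v i

/-- The `q`-integer `[k]_q = (1 - q^k) / (1 - q)`. -/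
def qInt {K : Type*} [Field K] (q : K) (k : ℕ) : K := (1 - q ^ k) / (1 - q)

/-- `d_λ(q)`: the product over the values `a` of `λ` (zero included) of `[1]_q ⋯ [m_a]_q`, where
`m_a` is the number of entries of `λ` that are equal to `a`. -/
def dFactor {K : Type*} [Field K] (q : K) {n : ℕ} (lam : Fin n → ℕ) : K :=
  ∏ a ∈ Finset.univ.image lam,
    ∏ j ∈ Finset.Icc 1 (Finset.univ.filter fun i => lam i = a).card, qInt q j

/-- The `q`-Key polynomial `U_v = (d_λ(q)⁻¹ x^λ) Y_{ζ(v)}`. -/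
def U {K : Type*} [Field K] (q : K) {n : ℕ} (v : Fin n → ℕ) : MvPolynomial (Fin n) K :=
  yangBaxter q (params q n) (zeta v) ((dFactor q (dominant v))⁻¹ • mono K (dominant v))

/-- The `q`-Key polynomial `Û_v = x^λ Ŷ_{η(v)}`. -/
def UHat {K : Type*} [Field K] (q : K) {n : ℕ} (v : Fin n → ℕ) : MvPolynomial (Fin n) K :=
  yangBaxter q (paramsRev q n) (eta v) (mono K (dominant v))

/-! ### The scalar product

Constant terms are taken in the field of Hahn series with exponents in `ℤ^n`, ordered
lexicographically with the exponent of `x_1` first. It contains the iterated Laurent series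
`K((x_n))…((x_1))`, so inverses are expanded first in powers of `x_1`, then of `x_2`, and so on,
and the coefficient at exponent `0` is the iterated constant term `CT_{x_n}(…(CT_{x_1}(·))…)`.
For `i < j` the exponent of `x_i / x_j` is positive, and `1 / (1 - q x_i / x_j)` is the
geometric series in `x_i / x_j`. -/

/-- The field of formal series in `x_1, …, x_n`. -/
abbrev Series (K : Type*) [Field K] (n : ℕ) : Type _ := HahnSeries (Lex (Fin n → ℤ)) K

/-- The variable `x_i` as a series. -/
def var (K : Type*) [Field K] {n : ℕ} (i : Fin n) : Series K n :=
  HahnSeries.single (toLex (Pi.single i 1)) 1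

/-- The series `Θ = ∏_{i<j} (1 - x_i/x_j) / (1 - q x_i/x_j)`. -/
def Theta {K : Type*} [Field K] (q : K) (n : ℕ) : Series K n :=
  ∏ p ∈ (Finset.univ : Finset (Fin n × Fin n)).filter (fun p => p.1 < p.2),
    (1 - var K p.1 / var K p.2) / (1 - HahnSeries.C q * (var K p.1 / var K p.2))

/-- The embedding of polynomials into series. -/
def toSeries (K : Type*) [Field K] (n : ℕ) : MvPolynomial (Fin n) K →ₐ[K] Series K n :=
  aeval (var K)

/-- The map `g ↦ g^♣`, which substitutes `1 / x_{n+1-i}` for `x_i`. -/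
def club (K : Type*) [Field K] (n : ℕ) : MvPolynomial (Fin n) K →ₐ[K] Series K n :=
  aeval fun i => (var K (Fin.rev i))⁻¹

/-- The bilinear form `(f, g)_q = CT(f g^♣ Θ)`. -/
def form {K : Type*} [Field K] (q : K) (n : ℕ) :
    LinearMap.BilinForm K (MvPolynomial (Fin n) K) :=
  LinearMap.mk₂ K (fun f g => (toSeries K n f * club K n g * Theta q n).coeff 0)
    (fun f f' g => by simp only [map_add, add_mul, HahnSeries.coeff_add])
    (fun c f g => by
      simp only [map_smul, smul_mul_assoc, HahnSeries.coeff_smul])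
    (fun f g g' => by simp only [map_add, mul_add, add_mul, HahnSeries.coeff_add])
    (fun c f g => by
      simp only [map_smul, smul_mul_assoc, mul_smul_comm, HahnSeries.coeff_smul])

/-! ### Hall-Littlewood polynomials -/

/-- The variable `x_i` as a rational function. -/
def ratVar (K : Type*) [Field K] {n : ℕ} (i : Fin n) : FractionRing (MvPolynomial (Fin n) K) :=
  algebraMap (MvPolynomial (Fin n) K) _ (X i)

/-- The Hall-Littlewood polynomial
`P_λ(x; q) = d_λ(q)⁻¹ ∑_{w ∈ S_n} w (x^λ ∏_{i<j} (x_i - q x_j) / (x_i - x_j))` of a partition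
`λ = (λ_1 ≥ … ≥ λ_n ≥ 0)`, as a rational function in `x_1, …, x_n`. -/
def hallLittlewood {K : Type*} [Field K] (q : K) {n : ℕ} (lam : Fin n → ℕ) :
    FractionRing (MvPolynomial (Fin n) K) :=
  algebraMap (MvPolynomial (Fin n) K) _ (C (dFactor q lam)⁻¹) *
    ∑ w : Equiv.Perm (Fin n), (∏ i, ratVar K (w i) ^ lam i) *
      ∏ p ∈ (Finset.univ : Finset (Fin n × Fin n)).filter (fun p => p.1 < p.2),
        (ratVar K (w p.1) - algebraMap (MvPolynomial (Fin n) K) _ (C q) * ratVar K (w p.2)) /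
          (ratVar K (w p.1) - ratVar K (w p.2))

end

end QKey

namespace QKey

noncomputable section

/-! ### Combinatorics of permutations -/

section Combinatorics

variable {n : ℕ}

/-! The operators `T_i` satisfy the Hecke relations. These, with a three-term relation between the
scalars in (1), give the Yang–Baxter equation, so (1) is independent of the chosen descents as soon
as the spectral parameters are nonzero and distinct (`yangBaxter_of_descent`). For the two choices
of parameters in the theorem, a step between values at distance `k` has scalar `c = (1-q)/(1-q^k)`,
respectively `1-q-c`. The two scalars are complementary: `(T_i + c)(T_i + 1-q-c)` is a scalar
operator.

Duality rests on three facts. First, `T_i` and `T_{n-i}` are adjoint for the form (`form_heckeT`):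
one factor of `Θ` absorbs the asymmetry of `T_i`, and the product of the others is symmetric in
`x_i, x_{i+1}`. Second, at a descent `v_i > v_{i+1}` both `U` and `Û` pass from `v` to `v s_i` by a
Yang–Baxter factor, while `T_i U_v = q U_v` if `v_i = v_{i+1}`; both recursions start from `x^λ`,
because `d_λ` is the eigenvalue of `Y_{ζ(λ)}` on `x^λ`. Third, `(U_v, x^μ)_q = δ_{v,μω}` for
dominant `μ` (`form_U_dominant`). The exponents of `Θ` pair nonnegatively with weakly decreasing
vectors, so a Cauchy–Schwarz type argument on squared norms kills almost all pairings of monomials,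
and `U_v` is unitriangular for the norm refined by `ℓ(ζ(v))`. An induction on `u` then moves each
`T_i` across the form; the complementarity of the scalars produces the required cancellation.

Independence follows from duality, spanning from a dimension count in each degree.

For the last part, `Y_ω` is expanded over the permutations with rational coefficients. Its image is
symmetric, so one coefficient determines all the others, and the coefficient of the longest
permutation is an explicit product over inversions. Hence `P_λ = U_{λω}`, and its duality with `x^μ
= Û_μ` is a special case. -/

theorem simple_lo (i : Fin (n - 1)) : simple i (lo i) = hi i := Equiv.swap_apply_left _ _

theorem simple_hi (i : Fin (n - 1)) : simple i (hi i) = lo i := Equiv.swap_apply_right _ _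

theorem simple_of_ne (i : Fin (n - 1)) {a : Fin n} (h1 : a ≠ lo i) (h2 : a ≠ hi i) :
    simple i a = a := Equiv.swap_apply_of_ne_of_ne h1 h2

@[simp] theorem simple_simple (i : Fin (n - 1)) (a : Fin n) : simple i (simple i a) = a :=
  Equiv.swap_apply_self _ _ a

@[simp] theorem simple_mul_self (i : Fin (n - 1)) : simple i * simple i = 1 :=
  Equiv.swap_mul_self _ _

@[simp] theorem mul_simple_mul_simple (σ : Equiv.Perm (Fin n)) (i : Fin (n - 1)) :
    σ * simple i * simple i = σ := by rw [mul_assoc, simple_mul_self, mul_one]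

@[simp] theorem comp_simple_comp_simple {α : Type*} (v : Fin n → α) (i : Fin (n - 1)) :
    (v ∘ simple i) ∘ simple i = v := by
  funext j; simp

/-- A function without adjacent descents is monotone. -/
theorem monotone_of_lo_le_hi {α : Type*} [Preorder α] {v : Fin n → α}
    (h : ∀ i : Fin (n - 1), v (lo i) ≤ v (hi i)) : Monotone v := by
  obtain _ | n := n
  · intro a; exact a.elim0
  · exact Fin.monotone_iff_le_succ.2 fun i => h i

theorem antitone_of_hi_le_lo {α : Type*} [Preorder α] {v : Fin n → α}
    (h : ∀ i : Fin (n - 1), v (hi i) ≤ v (lo i)) : Antitone v :=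
  monotone_of_lo_le_hi (α := αᵒᵈ) h

theorem exists_descent {σ : Equiv.Perm (Fin n)} (h : σ ≠ 1) :
    ∃ i : Fin (n - 1), σ (hi i) < σ (lo i) := by
  by_contra! hc
  exact h ((Equiv.Perm.monotone_iff σ).1 (monotone_of_lo_le_hi hc))

theorem ne_one_of_descent {σ : Equiv.Perm (Fin n)} {i : Fin (n - 1)} (h : σ (hi i) < σ (lo i)) :
    σ ≠ 1 := by
  rintro rfl
  exact absurd h (lo_lt_hi i).le.not_gt

/-- Every permutation is reached from the identity along ascents. -/
theorem perm_induction {P : Equiv.Perm (Fin n) → Prop} (one : P 1)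
    (step : ∀ (σ : Equiv.Perm (Fin n)) (i : Fin (n - 1)), σ (lo i) < σ (hi i) → P σ →
      P (σ * simple i)) (σ : Equiv.Perm (Fin n)) : P σ := by
  induction hm : length σ using Nat.strong_induction_on generalizing σ with
  | _ m ih =>
    by_cases h : σ = 1
    · exact h ▸ one
    · obtain ⟨i, hi'⟩ := exists_descent h
      have := step (σ * simple i) i (by simpa [simple_lo, simple_hi] using hi')
        (ih _ (hm ▸ length_mul_simple_lt σ i hi') _ rfl)
      simpa using this

theorem mem_inversions {σ : Equiv.Perm (Fin n)} {p : Fin n × Fin n} :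
    p ∈ inversions σ ↔ p.1 < p.2 ∧ σ p.2 < σ p.1 := by
  simp [inversions]

theorem inversions_one : inversions (1 : Equiv.Perm (Fin n)) = ∅ := by
  ext p
  simp only [mem_inversions, Equiv.Perm.one_apply, Finset.notMem_empty, iff_false, not_and,
    not_lt]
  exact fun h => h.le

/-- The action of a simple transposition on pairs of positions. -/
def pairSwap (i : Fin (n - 1)) : Fin n × Fin n ↪ Fin n × Fin n :=
  (simple i).toEmbedding.prodMap (simple i).toEmbedding

theorem pairSwap_apply (i : Fin (n - 1)) (p : Fin n × Fin n) :
    pairSwap i p = (simple i p.1, simple i p.2) := rfl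

theorem not_mem_inversions_map (σ : Equiv.Perm (Fin n)) (i : Fin (n - 1)) :
    (lo i, hi i) ∉ (inversions σ).map (pairSwap i) := by
  intro hm
  obtain ⟨p, hp, hpe⟩ := Finset.mem_map.1 hm
  have h1 : p.1 = hi i := by
    rw [← simple_simple i p.1, show simple i p.1 = lo i from congrArg Prod.fst hpe, simple_lo]
  have h2 : p.2 = lo i := by
    rw [← simple_simple i p.2, show simple i p.2 = hi i from congrArg Prod.snd hpe, simple_hi]
  have h3 := (Finset.mem_filter.1 hp).2.1
  rw [h1, h2] at h3
  exact absurd h3 (lo_lt_hi i).le.not_gt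

/-- Only the exchanged pair of positions becomes an inversion; all others are carried along. The
form with `cons` and `map` lets a product over inversions split off one factor at each ascent. -/
theorem inversions_mul_simple (σ : Equiv.Perm (Fin n)) (i : Fin (n - 1))
    (h : σ (lo i) < σ (hi i)) :
    inversions (σ * simple i) = Finset.cons (lo i, hi i) ((inversions σ).map (pairSwap i))
      (not_mem_inversions_map σ i) := by
  ext ⟨a, b⟩
  simp only [Finset.mem_cons, Finset.mem_map, mem_inversions, pairSwap_apply, Prod.mk.injEq,
    Equiv.Perm.mul_apply]
  constructor
  · rintro ⟨hab, hs⟩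
    by_cases he : a = lo i ∧ b = hi i
    · exact Or.inl he
    · exact Or.inr ⟨(simple i a, simple i b), ⟨simple_lt_simple i hab he, hs⟩, by simp⟩
  · rintro (⟨rfl, rfl⟩ | ⟨p, ⟨hp, hs⟩, rfl, rfl⟩)
    · exact ⟨lo_lt_hi i, by rwa [simple_lo, simple_hi]⟩
    · refine ⟨simple_lt_simple i hp ?_, by simpa using hs⟩
      rintro ⟨e1, e2⟩
      rw [e1, e2] at hs
      exact absurd hs h.le.not_gt

theorem length_mul_simple (σ : Equiv.Perm (Fin n)) (i : Fin (n - 1))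
    (h : σ (lo i) < σ (hi i)) : length (σ * simple i) = length σ + 1 := by
  rw [length, inversions_mul_simple σ i h, Finset.card_cons, Finset.card_map, length]

theorem length_mul_simple_le (σ : Equiv.Perm (Fin n)) (i : Fin (n - 1)) :
    length (σ * simple i) ≤ length σ + 1 := by
  rcases lt_or_ge (σ (lo i)) (σ (hi i)) with h | h
  · exact (length_mul_simple σ i h).le
  · have h' : σ (hi i) < σ (lo i) :=
      lt_of_le_of_ne h fun e => (lo_lt_hi i).ne' (σ.injective e)
    exact (length_mul_simple_lt σ i h').le.trans (Nat.le_succ _)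

/-! ### The permutations that sort a weight -/

theorem dominant_comp_perm (v : Fin n → ℕ) (σ : Equiv.Perm (Fin n)) :
    dominant (v ∘ σ) = dominant v := by
  unfold dominant
  rw [← Function.comp_assoc, ← Function.comp_assoc, Tuple.comp_perm_comp_sort_eq_comp_sort]

theorem dominant_comp_rev (v : Fin n → ℕ) : dominant (v ∘ Fin.rev) = dominant v :=
  dominant_comp_perm v Fin.revPerm

theorem dominant_of_antitone {v : Fin n → ℕ} (h : Antitone v) : dominant v = v :=
  (Tuple.unique_antitone (f := v) (σ := Fin.revPerm.trans (Tuple.sort v)) (τ := 1)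
    (dominant_antitone v) h)

/-- `σ` sorts `v`, and reverses the order of equal entries. -/
structure IsZeta (v : Fin n → ℕ) (σ : Equiv.Perm (Fin n)) : Prop where
  comp : dominant v ∘ σ = v
  anti : ∀ a b, a < b → v a = v b → σ b < σ a

/-- `σ` sorts `v`, and preserves the order of equal entries. -/
structure IsEta (v : Fin n → ℕ) (σ : Equiv.Perm (Fin n)) : Prop where
  comp : dominant v ∘ σ = v
  mono : ∀ a b, a < b → v a = v b → σ a < σ b

theorem lt_of_dominant_comp {v : Fin n → ℕ} {σ : Equiv.Perm (Fin n)} (h : dominant v ∘ σ = v)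
    {a b : Fin n} (hab : v a < v b) : σ b < σ a := by
  by_contra! hc
  have := dominant_antitone v hc
  rw [← Function.comp_apply (f := dominant v), ← Function.comp_apply (f := dominant v), h] at this
  exact absurd hab this.not_gt

theorem perm_eq_of_lt_imp_lt {σ τ : Equiv.Perm (Fin n)} (h : ∀ a b, σ a < σ b → τ a < τ b) :
    σ = τ := by
  have : τ * σ⁻¹ = 1 := by
    rw [← Equiv.Perm.monotone_iff]
    refine monotone_iff_forall_lt.2 fun a b hab => (h _ _ ?_).le
    simpa using hab
  exact (mul_inv_eq_one.1 this).symm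

/-- Sorting fixes the relative order at unequal entries, and the second condition fixes it at equal
ones. So `ζ` can be handled without mentioning its length. -/
theorem IsZeta.unique {v : Fin n → ℕ} {σ τ : Equiv.Perm (Fin n)} (hs : IsZeta v σ)
    (ht : IsZeta v τ) : σ = τ := by
  refine perm_eq_of_lt_imp_lt fun a b hab => ?_
  rcases lt_trichotomy (v a) (v b) with h | h | h
  · exact absurd (lt_of_dominant_comp hs.comp h) hab.le.not_gt
  · rcases lt_trichotomy a b with h' | rfl | h'
    · exact absurd (hs.anti a b h' h) hab.le.not_gt
    · exact absurd hab (lt_irrefl _)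
    · exact ht.anti b a h' h.symm
  · exact lt_of_dominant_comp ht.comp h

theorem IsEta.unique {v : Fin n → ℕ} {σ τ : Equiv.Perm (Fin n)} (hs : IsEta v σ)
    (ht : IsEta v τ) : σ = τ := by
  refine perm_eq_of_lt_imp_lt fun a b hab => ?_
  rcases lt_trichotomy (v a) (v b) with h | h | h
  · exact absurd (lt_of_dominant_comp hs.comp h) hab.le.not_gt
  · rcases lt_trichotomy a b with h' | rfl | h'
    · exact ht.mono a b h' h
    · exact absurd hab (lt_irrefl _)
    · exact absurd (hs.mono b a h' h.symm) hab.le.not_gt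
  · exact lt_of_dominant_comp ht.comp h

theorem exists_isZeta (v : Fin n → ℕ) : ∃ σ, IsZeta v σ := by
  refine ⟨(Tuple.sort v)⁻¹.trans Fin.revPerm, ?_, fun a b hab hv => ?_⟩
  · funext j
    simp [dominant]
  · have h := (Tuple.eq_sort_iff.1 (rfl : Tuple.sort v = Tuple.sort v)).2
    simp only [Equiv.trans_apply, Fin.revPerm_apply, Fin.rev_lt_rev]
    by_contra! hc
    rcases hc.lt_or_eq with hc | hc
    · have := h _ _ hc (by simp [hv])
      exact absurd (by simpa using this) hab.le.not_gt
    · exact hab.ne' ((Tuple.sort v)⁻¹.injective hc)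

theorem IsZeta.isEta_comp_rev {v : Fin n → ℕ} {σ : Equiv.Perm (Fin n)} (h : IsZeta v σ) :
    IsEta (v ∘ Fin.rev) (σ * Fin.revPerm) := by
  refine ⟨?_, fun a b hab hv => h.anti _ _ (Fin.rev_lt_rev.2 hab) hv.symm⟩
  rw [dominant_comp_rev]
  funext j
  exact congrFun h.comp (Fin.rev j)

theorem exists_isEta (v : Fin n → ℕ) : ∃ σ, IsEta v σ := by
  obtain ⟨σ, hσ⟩ := exists_isZeta (v ∘ Fin.rev)
  have := hσ.isEta_comp_rev
  refine ⟨σ * Fin.revPerm, ?_⟩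
  rwa [Function.comp_assoc, Fin.rev_involutive.comp_self, Function.comp_id] at this

/-- Sorting permutations invert the same pairs of unequal entries, and the order-reversing one
inverts all pairs of equal entries. Its inversions therefore contain those of any sorter, and
maximal length forces equality. -/
theorem isZeta_zeta (v : Fin n → ℕ) : IsZeta v (zeta v) := by
  obtain ⟨hm, hmax⟩ :=
    (Finset.exists_max_image (sorters v) length (sorters_nonempty v)).choose_spec
  change zeta v ∈ _ at hm
  obtain ⟨τ, hτ⟩ := exists_isZeta v
  have hcomp := (Finset.mem_filter.1 hm).2
  refine ⟨hcomp, ?_⟩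
  have hle : length τ ≤ length (zeta v) :=
    hmax τ (Finset.mem_filter.2 ⟨Finset.mem_univ _, hτ.comp⟩)
  have hsub : inversions (zeta v) ⊆ inversions τ := by
    intro p hp
    simp only [inversions, Finset.mem_filter, Finset.mem_univ, true_and] at hp ⊢
    refine ⟨hp.1, ?_⟩
    rcases lt_trichotomy (v p.1) (v p.2) with h | h | h
    · exact lt_of_dominant_comp hτ.comp h
    · exact hτ.anti _ _ hp.1 h
    · exact absurd (lt_of_dominant_comp hcomp h) hp.2.le.not_gt
  have heq := Finset.eq_of_subset_of_card_le hsub hle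
  intro a b hab hv
  have : (a, b) ∈ inversions τ := by
    simp only [inversions, Finset.mem_filter, Finset.mem_univ, true_and]
    exact ⟨hab, hτ.anti a b hab hv⟩
  rw [← heq] at this
  exact (Finset.mem_filter.1 this).2.2

theorem isEta_eta (v : Fin n → ℕ) : IsEta v (eta v) := by
  obtain ⟨hm, hmin⟩ :=
    (Finset.exists_min_image (sorters v) length (sorters_nonempty v)).choose_spec
  change eta v ∈ _ at hm
  obtain ⟨τ, hτ⟩ := exists_isEta v
  have hcomp := (Finset.mem_filter.1 hm).2
  refine ⟨hcomp, ?_⟩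
  have hle : length (eta v) ≤ length τ :=
    hmin τ (Finset.mem_filter.2 ⟨Finset.mem_univ _, hτ.comp⟩)
  have hsub : inversions τ ⊆ inversions (eta v) := by
    intro p hp
    simp only [inversions, Finset.mem_filter, Finset.mem_univ, true_and] at hp ⊢
    refine ⟨hp.1, ?_⟩
    rcases lt_trichotomy (v p.1) (v p.2) with h | h | h
    · exact lt_of_dominant_comp hcomp h
    · exact absurd (hτ.mono _ _ hp.1 h) hp.2.le.not_gt
    · exact absurd (lt_of_dominant_comp hτ.comp h) hp.2.le.not_gt
  have heq := Finset.eq_of_subset_of_card_le hsub hle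
  intro a b hab hv
  by_contra! hc
  have hc' : eta v b < eta v a := lt_of_le_of_ne hc fun e => hab.ne' ((eta v).injective e)
  have : (a, b) ∈ inversions (eta v) := by
    simp only [inversions, Finset.mem_filter, Finset.mem_univ, true_and]
    exact ⟨hab, hc'⟩
  rw [← heq] at this
  exact absurd (Finset.mem_filter.1 this).2.2 (hτ.mono a b hab hv).le.not_gt

/-- This matches the Yang–Baxter scalars of the two families when weights are paired through `ω`. -/
theorem eta_comp_rev (v : Fin n → ℕ) : eta (v ∘ Fin.rev) = zeta v * Fin.revPerm :=
  (isEta_eta _).unique (isZeta_zeta v).isEta_comp_rev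

theorem comp_simple_of_eq {α : Type*} {v : Fin n → α} {i : Fin (n - 1)}
    (h : v (lo i) = v (hi i)) : v ∘ simple i = v := by
  funext j
  by_cases h1 : j = lo i
  · rw [h1, Function.comp_apply, simple_lo, h]
  by_cases h2 : j = hi i
  · rw [h2, Function.comp_apply, simple_hi, h]
  rw [Function.comp_apply, simple_of_ne i h1 h2]

theorem simple_lt_simple_of_ne {α : Type*} {v : Fin n → α} {i : Fin (n - 1)}
    (h : v (lo i) ≠ v (hi i)) {a b : Fin n} (hab : a < b)
    (hv : v (simple i a) = v (simple i b)) : simple i a < simple i b := by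
  refine simple_lt_simple i hab ?_
  rintro ⟨rfl, rfl⟩
  rw [simple_lo, simple_hi] at hv
  exact h hv.symm

theorem zeta_comp_simple {v : Fin n → ℕ} {i : Fin (n - 1)} (h : v (lo i) ≠ v (hi i)) :
    zeta (v ∘ simple i) = zeta v * simple i := by
  refine (isZeta_zeta _).unique ⟨?_, fun a b hab hv => ?_⟩
  · rw [dominant_comp_perm]
    funext j
    exact congrFun (isZeta_zeta v).comp (simple i j)
  · exact (isZeta_zeta v).anti _ _ (simple_lt_simple_of_ne h hab hv) hv

theorem eta_comp_simple {v : Fin n → ℕ} {i : Fin (n - 1)} (h : v (lo i) ≠ v (hi i)) :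
    eta (v ∘ simple i) = eta v * simple i := by
  refine (isEta_eta _).unique ⟨?_, fun a b hab hv => ?_⟩
  · rw [dominant_comp_perm]
    funext j
    exact congrFun (isEta_eta v).comp (simple i j)
  · exact (isEta_eta v).mono _ _ (simple_lt_simple_of_ne h hab hv) hv

theorem zeta_lt_of_lt {v : Fin n → ℕ} {a b : Fin n} (h : v a < v b) : zeta v b < zeta v a :=
  lt_of_dominant_comp (isZeta_zeta v).comp h

theorem eta_lt_of_lt {v : Fin n → ℕ} {a b : Fin n} (h : v a < v b) : eta v b < eta v a :=
  lt_of_dominant_comp (isEta_eta v).comp h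

/-- A value strictly between the two would sit at a position with the same entry, because `λ` is
monotone. That position lies left or right of the adjacent pair, against the reversal of equal
entries. Distance one is what makes the corresponding Yang–Baxter factor equal to `□_i`. -/
theorem zeta_of_eq {v : Fin n → ℕ} {i : Fin (n - 1)} (h : v (lo i) = v (hi i)) :
    (zeta v (lo i) : ℕ) = zeta v (hi i) + 1 := by
  have hz := isZeta_zeta v
  have h1 : zeta v (hi i) < zeta v (lo i) := hz.anti _ _ (lo_lt_hi i) h
  by_contra hne
  have h2 : (zeta v (hi i) : ℕ) + 1 < zeta v (lo i) := by
    have : (zeta v (hi i) : ℕ) < zeta v (lo i) := h1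
    omega
  set c : Fin n := ⟨zeta v (hi i) + 1, h2.trans (zeta v (lo i)).2⟩ with hc
  obtain ⟨p, hp⟩ := (zeta v).surjective c
  have hc1 : zeta v (hi i) < zeta v p := by rw [hp, Fin.lt_def]; exact Nat.lt_succ_self _
  have hc2 : zeta v p < zeta v (lo i) := by rw [hp, Fin.lt_def]; exact h2
  have hv : v p = v (lo i) := by
    have e1 := dominant_antitone v hc1.le
    have e2 := dominant_antitone v hc2.le
    simp only [← Function.comp_apply (f := dominant v), hz.comp] at e1 e2
    omega
  have hpl : p ≠ lo i := fun e => (hc2.ne (by rw [e]))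
  have hph : p ≠ hi i := fun e => (hc1.ne' (by rw [e]))
  have d1 : (lo i).1 = i.1 := rfl
  have d2 : (hi i).1 = i.1 + 1 := rfl
  have : p < lo i ∨ hi i < p := by
    simp only [ne_eq, Fin.ext_iff, Fin.lt_def] at *
    omega
  rcases this with hlt | hlt
  · exact absurd (hz.anti _ _ hlt hv) hc2.le.not_gt
  · exact absurd (hz.anti _ _ hlt (by rw [hv, h])) hc1.le.not_gt

theorem eta_of_antitone {v : Fin n → ℕ} (h : Antitone v) : eta v = 1 :=
  (isEta_eta v).unique ⟨by rw [dominant_of_antitone h]; rfl, fun _ _ hab _ => hab⟩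

theorem antitone_comp_rev {v : Fin n → ℕ} (h : Antitone v) : Monotone (v ∘ Fin.rev) :=
  fun _ _ hab => h (Fin.rev_le_rev.2 hab)

theorem zeta_of_monotone {v : Fin n → ℕ} (h : Monotone v) : zeta v = Fin.revPerm := by
  refine (isZeta_zeta v).unique ⟨?_, fun _ _ hab _ => Fin.rev_lt_rev.2 hab⟩
  rw [← dominant_comp_rev, dominant_of_antitone (v := v ∘ Fin.rev) fun a b hab => h (Fin.rev_le_rev.2 hab)]
  funext j
  simp

/-- Every weight is reached from a dominant weight by exchanging descents. -/
theorem weight_induction {P : (Fin n → ℕ) → Prop} (dom : ∀ v, Antitone v → P v)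
    (step : ∀ v (i : Fin (n - 1)), v (hi i) < v (lo i) → P v → P (v ∘ simple i))
    (v : Fin n → ℕ) : P v := by
  induction hm : length (zeta v) using Nat.strong_induction_on generalizing v with
  | _ m ih =>
    by_cases h : ∀ i : Fin (n - 1), v (hi i) ≤ v (lo i)
    · exact dom v (antitone_of_hi_le_lo h)
    · push Not at h
      obtain ⟨i, hvi⟩ := h
      have := step (v ∘ simple i) i (by simpa [simple_lo, simple_hi] using hvi)
        (ih _ (by
          rw [← hm, zeta_comp_simple hvi.ne]
          exact length_mul_simple_lt _ i (zeta_lt_of_lt hvi)) _ rfl)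
      simpa using this

theorem lo_rev (i : Fin (n - 1)) : lo (Fin.rev i) = Fin.rev (hi i) := by
  ext; simp only [lo, hi, Fin.val_rev]; omega

theorem hi_rev (i : Fin (n - 1)) : hi (Fin.rev i) = Fin.rev (lo i) := by
  ext; simp only [lo, hi, Fin.val_rev]; omega

theorem simple_rev (i : Fin (n - 1)) (a : Fin n) :
    simple (Fin.rev i) (Fin.rev a) = Fin.rev (simple i a) := by
  unfold simple
  rw [lo_rev, hi_rev, Equiv.swap_comm, Equiv.swap_apply_def, Equiv.swap_apply_def]
  simp only [Fin.rev_inj]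
  split_ifs <;> rfl

theorem comp_simple_comp_rev {α : Type*} (v : Fin n → α) (i : Fin (n - 1)) :
    (v ∘ simple i) ∘ Fin.rev = (v ∘ Fin.rev) ∘ simple (Fin.rev i) := by
  funext a
  simp only [Function.comp_apply]
  rw [← Fin.rev_rev a, simple_rev, Fin.rev_rev, Fin.rev_rev]

end Combinatorics

/-! ### The operators on rational functions -/

section Operators

variable {K : Type*} [Field K] {n : ℕ}

/-- The action of a permutation on rational functions. -/
def permFrac (K : Type*) [Field K] {n : ℕ} (w : Equiv.Perm (Fin n)) :
    FractionRing (MvPolynomial (Fin n) K) →+* FractionRing (MvPolynomial (Fin n) K) :=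
  IsFractionRing.map (j := (rename w : MvPolynomial (Fin n) K →ₐ[K] _).toRingHom)
    (rename_injective w w.injective)

theorem permFrac_algebraMap (w : Equiv.Perm (Fin n)) (f : MvPolynomial (Fin n) K) :
    permFrac K w (algebraMap _ _ f) = algebraMap _ _ (rename w f) :=
  IsLocalization.map_eq (S := FractionRing (MvPolynomial (Fin n) K))
    (nonZeroDivisors_le_comap_nonZeroDivisors_of_injective _ (rename_injective w w.injective)) f

theorem permFrac_ratVar (w : Equiv.Perm (Fin n)) (a : Fin n) :
    permFrac K w (ratVar K a) = ratVar K (w a) := by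
  rw [ratVar, permFrac_algebraMap, rename_X, ratVar]

/-- A scalar as a rational function. -/
def ratC (K : Type*) [Field K] (n : ℕ) (c : K) : FractionRing (MvPolynomial (Fin n) K) :=
  algebraMap (MvPolynomial (Fin n) K) _ (C c)

theorem permFrac_ratC (w : Equiv.Perm (Fin n)) (c : K) :
    permFrac K w (ratC K n c) = ratC K n c := by
  rw [ratC, permFrac_algebraMap, rename_C]

theorem permFrac_permFrac (w w' : Equiv.Perm (Fin n))
    (x : FractionRing (MvPolynomial (Fin n) K)) :
    permFrac K w (permFrac K w' x) = permFrac K (w * w') x := by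
  have : (permFrac K w).comp (permFrac K w') = permFrac K (w * w') := by
    refine IsLocalization.ringHom_ext (nonZeroDivisors (MvPolynomial (Fin n) K)) ?_
    ext f
    · simp [permFrac_algebraMap]
    · simp [permFrac_algebraMap]
  exact congrArg (fun g => g x) this

theorem ratVar_injective : Function.Injective (ratVar K : Fin n → _) :=
  (IsFractionRing.injective (MvPolynomial (Fin n) K) _).comp (X_injective)

theorem ratVar_sub_ne_zero {a b : Fin n} (h : a ≠ b) : ratVar K a - ratVar K b ≠ 0 :=
  sub_ne_zero.2 (ratVar_injective.ne h)

theorem mul_square (q : K) (i : Fin (n - 1)) (f : MvPolynomial (Fin n) K) :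
    (X (lo i) - X (hi i)) * square q i f = (X (lo i) - C q * X (hi i)) * f
      - (X (hi i) - C q * X (lo i)) * rename (simple i) f := by
  have : square q i f = divDiffFun i ((X (lo i) - C q * X (hi i)) * f) := rfl
  rw [this, mul_divDiffFun]
  simp [simple_lo, simple_hi]

theorem rename_square (q : K) (i : Fin (n - 1)) (f : MvPolynomial (Fin n) K) :
    rename (simple i) (square q i f) = square q i f := by
  have h : rename (simple i) (rename (simple i) f) = f := by
    rw [rename_rename]
    convert rename_id_apply f
    funext a; simp
  have h1 := congrArg (rename (simple i)) (mul_square q i f)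
  apply mul_left_cancel₀ (X_sub_X_ne_zero (K := K) i)
  rw [mul_square]
  simp only [map_mul, map_sub, rename_X, simple_lo, simple_hi, rename_C, h] at h1
  linear_combination -h1

/-- Over the rational functions `T_i` is a combination of the identity and `s_i`, so relations
between these operators become identities between rational coefficients. -/
theorem algebraMap_heckeT (q : K) (i : Fin (n - 1)) (f : MvPolynomial (Fin n) K) :
    algebraMap _ (FractionRing (MvPolynomial (Fin n) K)) (heckeT q i f) =
      ((ratVar K (lo i) - ratC K n q * ratVar K (hi i)) * algebraMap _ _ f
        - (ratVar K (hi i) - ratC K n q * ratVar K (lo i)) *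
          permFrac K (simple i) (algebraMap _ _ f)) / (ratVar K (lo i) - ratVar K (hi i))
        - algebraMap _ _ f := by
  have h := congrArg (algebraMap _ (FractionRing (MvPolynomial (Fin n) K))) (mul_square q i f)
  have h0 := ratVar_sub_ne_zero (K := K) (lo_lt_hi i).ne
  have : heckeT q i f = square q i f - f := rfl
  rw [this, map_sub, permFrac_algebraMap]
  congr 1
  rw [eq_div_iff h0, mul_comm]
  simpa only [map_mul, map_sub, ratVar, ratC] using h

/-- Since `□_i f` is symmetric in `x_i, x_{i+1}`, one has `□_i² = (1+q) □_i`. -/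
theorem heckeT_mul_self (q : K) (i : Fin (n - 1)) :
    heckeT q i * heckeT q i = (q - 1) • heckeT q i + q • 1 := by
  refine LinearMap.ext fun f => ?_
  have h := rename_square q i f
  have h1 : square q i (square q i f) = (1 + C q) * square q i f := by
    apply mul_left_cancel₀ (X_sub_X_ne_zero (K := K) i)
    rw [mul_square, h]
    ring
  have h2 : ∀ g, heckeT q i g = square q i g - g := fun g => rfl
  simp only [Module.End.mul_apply, LinearMap.add_apply, LinearMap.smul_apply, h2, map_sub, h1,
    Module.End.one_apply, smul_eq_C_mul]
  simp only [C_1]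
  ring

theorem simple_mul_comm {i j : Fin (n - 1)} (h : (i : ℕ) + 1 < j) :
    simple i * simple j = simple j * simple i := by
  unfold simple
  refine (Equiv.Perm.disjoint_swap_swap ?_).commute
  simp only [List.nodup_cons, List.mem_cons, List.not_mem_nil, Fin.ext_iff, lo, hi]
  simp
  omega

theorem simple_braid {i j : Fin (n - 1)} (h : hi i = lo j) :
    simple i * simple j * simple i = simple j * simple i * simple j := by
  have h1 := (lo_lt_hi i).ne
  have h2 := (lo_lt_hi j).ne
  have h3 : lo i ≠ hi j := ((lo_lt_hi i).trans (h ▸ lo_lt_hi j)).ne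
  unfold simple
  rw [h] at h1 ⊢
  ext a
  simp only [Equiv.Perm.mul_apply, Equiv.swap_apply_def]
  grind

theorem heckeT_comm (q : K) {i j : Fin (n - 1)} (h : (i : ℕ) + 1 < j) :
    heckeT q i * heckeT q j = heckeT q j * heckeT q i := by
  refine LinearMap.ext fun f => ?_
  apply IsFractionRing.injective (MvPolynomial (Fin n) K)
    (FractionRing (MvPolynomial (Fin n) K))
  have d1 : (lo i).1 = i.1 := rfl
  have d2 : (hi i).1 = i.1 + 1 := rfl
  have d3 : (lo j).1 = j.1 := rfl
  have d4 : (hi j).1 = j.1 + 1 := rfl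
  have a1 : simple i (lo j) = lo j := simple_of_ne i (by rw [ne_eq, Fin.ext_iff]; omega)
    (by rw [ne_eq, Fin.ext_iff]; omega)
  have a2 : simple i (hi j) = hi j := simple_of_ne i (by rw [ne_eq, Fin.ext_iff]; omega)
    (by rw [ne_eq, Fin.ext_iff]; omega)
  have a3 : simple j (lo i) = lo i := simple_of_ne j (by rw [ne_eq, Fin.ext_iff]; omega)
    (by rw [ne_eq, Fin.ext_iff]; omega)
  have a4 : simple j (hi i) = hi i := simple_of_ne j (by rw [ne_eq, Fin.ext_iff]; omega)
    (by rw [ne_eq, Fin.ext_iff]; omega)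
  have e1 := ratVar_sub_ne_zero (K := K) (lo_lt_hi i).ne
  have e2 := ratVar_sub_ne_zero (K := K) (lo_lt_hi j).ne
  simp only [Module.End.mul_apply, algebraMap_heckeT, map_sub, map_div₀, map_mul, permFrac_ratC,
    permFrac_ratVar, a1, a2, a3, a4, permFrac_permFrac, simple_mul_comm h]
  field_simp
  ring

theorem heckeT_braid (q : K) {i j : Fin (n - 1)} (h : hi i = lo j) :
    heckeT q i * heckeT q j * heckeT q i = heckeT q j * heckeT q i * heckeT q j := by
  refine LinearMap.ext fun f => ?_
  apply IsFractionRing.injective (MvPolynomial (Fin n) K)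
    (FractionRing (MvPolynomial (Fin n) K))
  have h1 := (lo_lt_hi i).ne
  have h2 := (lo_lt_hi j).ne
  have h3 : lo i ≠ hi j := ((lo_lt_hi i).trans (h ▸ lo_lt_hi j)).ne
  have a0 := simple_lo i
  have b0 := simple_hi i
  have a1 : simple i (hi j) = hi j := simple_of_ne i h3.symm (h ▸ h2.symm)
  have a2 : simple j (lo i) = lo i := simple_of_ne j (h ▸ h1) h3
  have a3 := simple_lo j
  have a4 := simple_hi j
  have e1 := ratVar_sub_ne_zero (K := K) h1
  have e2 := ratVar_sub_ne_zero (K := K) h2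
  have e3 := ratVar_sub_ne_zero (K := K) h3
  have e4 := ratVar_sub_ne_zero (K := K) h1.symm
  have e5 := ratVar_sub_ne_zero (K := K) h2.symm
  rw [h] at e1 e4 a0 b0
  have hb := simple_braid h
  simp only [Module.End.mul_apply, algebraMap_heckeT, map_sub, map_div₀, map_mul, permFrac_ratC,
    permFrac_ratVar, a0, b0, a1, a2, a3, a4, permFrac_permFrac, h, ← mul_assoc, hb,
    simple_mul_self]
  have h11 : permFrac K (1 : Equiv.Perm (Fin n)) (algebraMap _ _ f) = algebraMap _ _ f := by
    rw [permFrac_algebraMap]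
    exact congrArg _ (rename_id_apply f)
  simp only [h11]
  field_simp
  ring

end Operators

/-! ### The Yang-Baxter elements -/

section YangBaxter

variable {K : Type*} [Field K] {n : ℕ}

/-- The Yang-Baxter equation for elements of an algebra that satisfy the Hecke relations. -/
theorem yangBaxter_equation {A : Type*} [Ring A] [Algebra K A] {q c₁ c₂ c₃ : K} {s t : A}
    (hs : s * s = (q - 1) • s + q • 1) (ht : t * t = (q - 1) • t + q • 1)
    (hst : s * t * s = t * s * t) (hc : c₂ * (q - 1 + c₁ + c₃) = c₁ * c₃) :
    (s + c₁ • 1) * (t + c₂ • 1) * (s + c₃ • 1) = (t + c₃ • 1) * (s + c₂ • 1) * (t + c₁ • 1) := by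
  simp only [add_mul, mul_add, smul_mul_assoc, mul_smul_comm, one_mul, mul_one, hst, hs, ht]
  -- All coefficients agree formally except those of `s` and of `t`; each of these is `hc` up to
  -- sign.
  match_scalars <;> first
    | ring1
    | linear_combination hc
    | linear_combination -hc

/-- The scalar in the recursion for the Yang-Baxter elements. -/
def ybCoeff (q : K) (u : Fin n → K) (a b : Fin n) : K := (1 - q) / (1 - u b / u a)

/-- Each scalar is `(1-q) u_a / (u_a - u_b)`, which turns this into an identity of rational
functions. It is the condition on scalars in `yangBaxter_equation`. -/
theorem ybCoeff_relation {q : K} {u : Fin n → K} (h0 : ∀ a, u a ≠ 0)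
    (hu : Function.Injective u) {a b c : Fin n} (hab : a ≠ b) (hbc : b ≠ c) (hac : a ≠ c) :
    ybCoeff q u a c * (q - 1 + ybCoeff q u b c + ybCoeff q u a b)
      = ybCoeff q u b c * ybCoeff q u a b := by
  have e : ∀ {x y : Fin n}, x ≠ y → ybCoeff q u x y = (1 - q) * u x / (u x - u y) := by
    intro x y h
    have h1 := sub_ne_zero.2 (hu.ne h)
    have h2 := h0 x
    unfold ybCoeff
    rw [one_sub_div h2]
    field_simp
  rw [e hab, e hbc, e hac]
  have h1 := sub_ne_zero.2 (hu.ne hab)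
  have h2 := sub_ne_zero.2 (hu.ne hbc)
  have h3 := sub_ne_zero.2 (hu.ne hac)
  field_simp
  ring

/-- The factor of the Yang-Baxter elements for a descent from the value `b` to the value `a`. -/
def ybFactor (q : K) (u : Fin n → K) (i : Fin (n - 1)) (a b : Fin n) :
    Module.End K (MvPolynomial (Fin n) K) :=
  heckeT q i + ybCoeff q u a b • 1

theorem exists_descent_yangBaxter (q : K) (u : Fin n → K) {σ : Equiv.Perm (Fin n)}
    (h : ∃ i : Fin (n - 1), σ (hi i) < σ (lo i)) :
    ∃ i : Fin (n - 1), σ (hi i) < σ (lo i) ∧ yangBaxter q u σ =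
      ybFactor q u i (σ (hi i)) (σ (lo i)) * yangBaxter q u (σ * simple i) := by
  refine ⟨h.choose, h.choose_spec, ?_⟩
  rw [yangBaxter, dif_pos h]
  rfl

theorem yangBaxter_one (q : K) (u : Fin n → K) : yangBaxter q u 1 = 1 := by
  rw [yangBaxter, dif_neg]
  rintro ⟨i, h⟩
  exact ne_one_of_descent h rfl

theorem ybFactor_comm (q : K) (u : Fin n → K) {i j : Fin (n - 1)} (h : (i : ℕ) + 1 < j)
    (a b c d : Fin n) :
    ybFactor q u i a b * ybFactor q u j c d = ybFactor q u j c d * ybFactor q u i a b := by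
  simp only [ybFactor, add_mul, mul_add, smul_mul_assoc, mul_smul_comm, one_mul, mul_one,
    heckeT_comm q h]
  match_scalars <;> ring

theorem ybFactor_braid {q : K} {u : Fin n → K} (h0 : ∀ a, u a ≠ 0) (hu : Function.Injective u)
    {i j : Fin (n - 1)} (h : hi i = lo j) {a b c : Fin n} (hab : a < b) (hbc : b < c) :
    ybFactor q u i b c * ybFactor q u j a c * ybFactor q u i a b =
      ybFactor q u j a b * ybFactor q u i a c * ybFactor q u j b c :=
  yangBaxter_equation (heckeT_mul_self q i) (heckeT_mul_self q j) (heckeT_braid q h)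
    (ybCoeff_relation h0 hu hab.ne hbc.ne (hab.trans hbc).ne)

/-- The definition uses one chosen descent; this shows that any descent gives the same operator. By
induction on length, two descents are compared through a common shorter permutation: distant ones
commute, and adjacent ones are joined by the Yang–Baxter equation. -/
theorem yangBaxter_of_descent {q : K} {u : Fin n → K} (h0 : ∀ a, u a ≠ 0)
    (hu : Function.Injective u) (σ : Equiv.Perm (Fin n)) (i : Fin (n - 1))
    (hσ : σ (hi i) < σ (lo i)) :
    yangBaxter q u σ =
      ybFactor q u i (σ (hi i)) (σ (lo i)) * yangBaxter q u (σ * simple i) := by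
  induction hm : length σ using Nat.strong_induction_on generalizing σ i with
  | _ m ih =>
    obtain ⟨j, hj, hY⟩ := exists_descent_yangBaxter q u ⟨i, hσ⟩
    have step : ∀ (τ : Equiv.Perm (Fin n)) (k : Fin (n - 1)), length τ < length σ →
        τ (hi k) < τ (lo k) → yangBaxter q u τ =
          ybFactor q u k (τ (hi k)) (τ (lo k)) * yangBaxter q u (τ * simple k) :=
      fun τ k hτ hk => ih _ (hm ▸ hτ) τ k hk rfl
    have len : ∀ (τ : Equiv.Perm (Fin n)) (k : Fin (n - 1)), τ (hi k) < τ (lo k) →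
        length (τ * simple k) < length τ := length_mul_simple_lt
    rw [hY]
    clear ih hY
    -- distant descents
    have far : ∀ i j : Fin (n - 1), (i : ℕ) + 1 < j → σ (hi i) < σ (lo i) →
        σ (hi j) < σ (lo j) →
        ybFactor q u i (σ (hi i)) (σ (lo i)) * yangBaxter q u (σ * simple i) =
          ybFactor q u j (σ (hi j)) (σ (lo j)) * yangBaxter q u (σ * simple j) := by
      intro i j hij hσi hσj
      have a1 : simple i (lo j) = lo j := simple_of_ne i
        (by simp only [ne_eq, Fin.ext_iff, lo]; omega)
        (by simp only [ne_eq, Fin.ext_iff, lo, hi]; omega)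
      have a2 : simple i (hi j) = hi j := simple_of_ne i
        (by simp only [ne_eq, Fin.ext_iff, lo, hi]; omega)
        (by simp only [ne_eq, Fin.ext_iff, hi]; omega)
      have a3 : simple j (lo i) = lo i := simple_of_ne j
        (by simp only [ne_eq, Fin.ext_iff, lo]; omega)
        (by simp only [ne_eq, Fin.ext_iff, lo, hi]; omega)
      have a4 : simple j (hi i) = hi i := simple_of_ne j
        (by simp only [ne_eq, Fin.ext_iff, lo, hi]; omega)
        (by simp only [ne_eq, Fin.ext_iff, hi]; omega)
      rw [step (σ * simple i) j (len σ i hσi) (by simpa [a1, a2] using hσj),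
        step (σ * simple j) i (len σ j hσj) (by simpa [a3, a4] using hσi)]
      simp only [Equiv.Perm.mul_apply, a1, a2, a3, a4]
      rw [mul_assoc σ, mul_assoc σ, simple_mul_comm hij, ← mul_assoc, ← mul_assoc,
        ybFactor_comm q u hij, mul_assoc]
    -- adjacent descents
    have near : ∀ i j : Fin (n - 1), hi i = lo j → σ (hi i) < σ (lo i) →
        σ (hi j) < σ (lo j) →
        ybFactor q u i (σ (hi i)) (σ (lo i)) * yangBaxter q u (σ * simple i) =
          ybFactor q u j (σ (hi j)) (σ (lo j)) * yangBaxter q u (σ * simple j) := by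
      intro i j hij hσi hσj
      have h1 := (lo_lt_hi i).ne
      have h2 := (lo_lt_hi j).ne
      have h3 : lo i ≠ hi j := ((lo_lt_hi i).trans (hij ▸ lo_lt_hi j)).ne
      have b1 := simple_lo i
      have b2 := simple_hi i
      have b3 : simple i (hi j) = hi j := simple_of_ne i h3.symm (hij ▸ h2.symm)
      have b4 : simple j (lo i) = lo i := simple_of_ne j (hij ▸ h1) h3
      have b5 := simple_lo j
      have b6 := simple_hi j
      rw [hij] at b1 b2 hσi ⊢
      have hσij := hσj.trans hσi
      have s1 : (σ * simple i) (hi j) < (σ * simple i) (lo j) := by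
        simpa [b2, b3] using hσij
      have s2 : (σ * simple i * simple j) (hi i) < (σ * simple i * simple j) (lo i) := by
        simpa [hij, b1, b2, b3, b4, b5, b6] using hσj
      have s3 : (σ * simple j) (hi i) < (σ * simple j) (lo i) := by
        simpa [hij, b4, b5] using hσij
      have s4 : (σ * simple j * simple i) (hi j) < (σ * simple j * simple i) (lo j) := by
        simpa [hij, b1, b2, b3, b4, b5, b6] using hσi
      have l1 := len σ i (by rwa [hij])
      have l2 := len σ j hσj
      rw [step _ j l1 s1, step _ i ((len _ j s1).trans l1) s2, step _ i l2 s3,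
        step _ j ((len _ i s3).trans l2) s4]
      simp only [Equiv.Perm.mul_apply, hij, b1, b2, b3, b4, b5, b6]
      rw [mul_assoc σ, mul_assoc σ, mul_assoc σ, mul_assoc σ, simple_braid hij, ← mul_assoc,
        ← mul_assoc, ← mul_assoc, ← mul_assoc, ybFactor_braid h0 hu hij hσj hσi]
      simp only [mul_assoc]
    rcases lt_trichotomy (i : ℕ) j with h | h | h
    · rcases (Nat.succ_le_of_lt h).lt_or_eq with h' | h'
      · exact (far i j h' hσ hj).symm
      · exact (near i j (Fin.ext h') hσ hj).symm
    · rw [Fin.ext h]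
    · rcases (Nat.succ_le_of_lt h).lt_or_eq with h' | h'
      · exact far j i h' hj hσ
      · exact near j i (Fin.ext h') hj hσ

/-- The recursion that defines the Yang-Baxter elements is consistent for generic spectral
parameters. -/
theorem isYangBaxter_yangBaxter {q : K} {u : Fin n → K} (h0 : ∀ a, u a ≠ 0)
    (hu : Function.Injective u) : IsYangBaxter q u (yangBaxter q u) where
  one := yangBaxter_one q u
  step σ i h := by
    rw [yangBaxter_of_descent h0 hu (σ * simple i) i (by simpa [simple_lo, simple_hi] using h)]
    simp [simple_lo, simple_hi, ybFactor, ybCoeff]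

variable {q : K}

/-! ### Specialization of the spectral parameters to powers of `q` -/

theorem pow_injective_of_pow_ne_one (hq0 : q ≠ 0) (hq : ∀ k, 0 < k → q ^ k ≠ 1) :
    Function.Injective fun k : ℕ => q ^ k := by
  have : ∀ a b : ℕ, a < b → q ^ a ≠ q ^ b := by
    intro a b hab h
    refine hq (b - a) (by omega) (mul_left_cancel₀ (pow_ne_zero a hq0) ?_)
    rw [← pow_add, mul_one, h, Nat.add_sub_cancel' hab.le]
  intro a b h
  rcases lt_trichotomy a b with h' | h' | h'
  · exact absurd h (this a b h')
  · exact h'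
  · exact absurd h.symm (this b a h')

theorem isYangBaxter_params (hq0 : q ≠ 0) (hq : ∀ k, 0 < k → q ^ k ≠ 1) :
    IsYangBaxter q (params q n) (yangBaxter q (params q n)) :=
  isYangBaxter_yangBaxter (fun _ => pow_ne_zero _ hq0)
    fun _ _ h => Fin.ext (pow_injective_of_pow_ne_one hq0 hq h)

theorem isYangBaxter_paramsRev (hq0 : q ≠ 0) (hq : ∀ k, 0 < k → q ^ k ≠ 1) :
    IsYangBaxter q (paramsRev q n) (yangBaxter q (paramsRev q n)) :=
  isYangBaxter_yangBaxter (fun _ => pow_ne_zero _ hq0)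
    fun _ _ h => Fin.rev_injective (Fin.ext (pow_injective_of_pow_ne_one hq0 hq h))

/-- The Yang-Baxter scalar for the parameters `(1, q, …)`. -/
def cUp (q : K) (k : ℕ) : K := (1 - q) / (1 - q ^ k)

theorem yangBaxter_params_mul_simple (hq0 : q ≠ 0) (hq : ∀ k, 0 < k → q ^ k ≠ 1)
    (σ : Equiv.Perm (Fin n)) (i : Fin (n - 1)) (h : σ (lo i) < σ (hi i)) :
    yangBaxter q (params q n) (σ * simple i) =
      (heckeT q i + cUp q ((σ (hi i) : ℕ) - σ (lo i)) • 1) * yangBaxter q (params q n) σ := by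
  rw [(isYangBaxter_params hq0 hq).step σ i h]
  simp only [params, cUp]
  have h' : (σ (lo i) : ℕ) ≤ σ (hi i) := h.le
  rw [pow_sub₀ q hq0 h', div_eq_mul_inv (q ^ _) (q ^ _)]

/-- Reversing the parameters replaces `q^k` by `q^{-k}`, and `(1-q)/(1-q^k) + (1-q)/(1-q^{-k}) =
1-q`. -/
theorem yangBaxter_paramsRev_mul_simple (hq0 : q ≠ 0) (hq : ∀ k, 0 < k → q ^ k ≠ 1)
    (σ : Equiv.Perm (Fin n)) (i : Fin (n - 1)) (h : σ (lo i) < σ (hi i)) :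
    yangBaxter q (paramsRev q n) (σ * simple i) =
      (heckeT q i + (1 - q - cUp q ((σ (hi i) : ℕ) - σ (lo i))) • 1) *
        yangBaxter q (paramsRev q n) σ := by
  rw [(isYangBaxter_paramsRev hq0 hq).step σ i h]
  have h' : (σ (lo i) : ℕ) < σ (hi i) := h
  have h2 := (σ (hi i)).2
  congr 3
  simp only [paramsRev, cUp, Fin.val_rev]
  have e : q ^ (n - ((σ (lo i) : ℕ) + 1)) =
      q ^ (n - ((σ (hi i) : ℕ) + 1)) * q ^ ((σ (hi i) : ℕ) - σ (lo i)) := by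
    rw [← pow_add]; congr 1; omega
  rw [e]
  have h3 : q ^ (n - ((σ (hi i) : ℕ) + 1)) ≠ 0 := pow_ne_zero _ hq0
  have h4 : q ^ ((σ (hi i) : ℕ) - σ (lo i)) ≠ 0 := pow_ne_zero _ hq0
  have h5 := hq ((σ (hi i) : ℕ) - σ (lo i)) (by omega)
  generalize q ^ ((σ (hi i) : ℕ) - σ (lo i)) = y at *
  generalize q ^ (n - ((σ (hi i) : ℕ) + 1)) = z at *
  have h6 : 1 - y ≠ 0 := sub_ne_zero.2 h5.symm
  have h7 : y - 1 ≠ 0 := sub_ne_zero.2 h5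
  have e2 : z / (z * y) = 1 / y := by field_simp
  rw [e2, one_sub_div h4]
  field_simp
  ring

end YangBaxter

/-! ### The action on monomials -/

section Monomials

variable {K : Type*} [Field K] {n : ℕ}

theorem mono_add (v w : Fin n → ℕ) : mono K (v + w) = mono K v * mono K w := by
  simp [mono, pow_add, Finset.prod_mul_distrib]

theorem mono_single (j : Fin n) (c : ℕ) : mono K (Pi.single j c) = X j ^ c := by
  unfold mono
  rw [Finset.prod_eq_single j]
  · simp
  · intro b _ hb
    simp [hb]
  · simp

theorem mono_eq_monomial (v : Fin n → ℕ) :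
    mono K v = monomial (Finsupp.equivFunOnFinite.symm v) 1 := by
  rw [MvPolynomial.monomial_eq, Finsupp.prod_fintype _ _ (by simp)]
  simp [mono]

theorem rename_mono (i : Fin (n - 1)) (v : Fin n → ℕ) :
    rename (simple i) (mono K v) = mono K (v ∘ simple i) := by
  simp only [mono, map_prod, map_pow, rename_X]
  rw [← Equiv.prod_comp (simple i)]
  simp

/-- The squared norm of a weight. -/
def nsq (v : Fin n → ℕ) : ℕ := ∑ j, v j ^ 2

/-- The degree of a weight. -/
def deg (v : Fin n → ℕ) : ℕ := ∑ j, v j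

theorem nsq_comp_perm (v : Fin n → ℕ) (σ : Equiv.Perm (Fin n)) : nsq (v ∘ σ) = nsq v :=
  Equiv.sum_comp σ fun j => v j ^ 2

theorem deg_comp_perm (v : Fin n → ℕ) (σ : Equiv.Perm (Fin n)) : deg (v ∘ σ) = deg v :=
  Equiv.sum_comp σ v

theorem deg_add_single (v : Fin n → ℕ) (j : Fin n) (c : ℕ) :
    deg (v + Pi.single j c) = deg v + c := by
  simp [deg, Finset.sum_add_distrib]

theorem nsq_add_single (v : Fin n → ℕ) (j : Fin n) (c : ℕ) :
    nsq (v + Pi.single j c) = nsq v + (2 * v j * c + c ^ 2) := by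
  have : ∀ k, (v + Pi.single j c : Fin n → ℕ) k ^ 2 =
      v k ^ 2 + if k = j then 2 * v j * c + c ^ 2 else 0 := by
    intro k
    by_cases h : k = j
    · subst h; simp; ring
    · simp [h]
  simp only [nsq, this, Finset.sum_add_distrib, Finset.sum_ite_eq', Finset.mem_univ, if_true]

theorem heckeT_of_rename_eq (q : K) (i : Fin (n - 1)) {f : MvPolynomial (Fin n) K}
    (h : rename (simple i) f = f) : heckeT q i f = q • f := by
  apply mul_left_cancel₀ (X_sub_X_ne_zero (K := K) i)
  have : heckeT q i f = square q i f - f := rfl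
  rw [this, mul_sub, mul_square, h, smul_eq_C_mul]
  ring

theorem heckeT_mul_of_rename_eq (q : K) (i : Fin (n - 1)) {g : MvPolynomial (Fin n) K}
    (h : rename (simple i) g = g) (f : MvPolynomial (Fin n) K) :
    heckeT q i (g * f) = g * heckeT q i f := by
  apply mul_left_cancel₀ (X_sub_X_ne_zero (K := K) i)
  have : ∀ f, heckeT q i f = square q i f - f := fun _ => rfl
  rw [this, this, mul_sub, mul_square, map_mul, h]
  linear_combination -g * mul_square q i f

theorem heckeT_X_pow (q : K) (i : Fin (n - 1)) (m : ℕ) :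
    heckeT q i (X (lo i) ^ (m + 1) : MvPolynomial (Fin n) K) = X (hi i) ^ (m + 1) +
      (1 - q) • ∑ c ∈ Finset.range m, X (lo i) ^ (c + 1) * X (hi i) ^ (m - c) := by
  have hsum : ∑ c ∈ Finset.range m, (X (lo i) ^ (c + 1) * X (hi i) ^ (m - c) :
      MvPolynomial (Fin n) K) = X (lo i) * X (hi i) *
        ∑ c ∈ Finset.range m, X (lo i) ^ c * X (hi i) ^ (m - 1 - c) := by
    rw [Finset.mul_sum]
    refine Finset.sum_congr rfl fun c hc => ?_
    have hc' := Finset.mem_range.1 hc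
    rw [show m - c = (m - 1 - c) + 1 by omega]
    ring
  have h := geom_sum₂_mul (X (lo i) : MvPolynomial (Fin n) K) (X (hi i)) m
  apply mul_left_cancel₀ (X_sub_X_ne_zero (K := K) i)
  have : ∀ f, heckeT q i f = square q i f - f := fun _ => rfl
  rw [this, mul_sub, mul_square, hsum, smul_eq_C_mul, map_pow, rename_X, simple_lo]
  simp only [map_sub, C_1]
  linear_combination -(1 - C q) * X (lo i) * X (hi i) * h

/-- The span of a set of monomials. -/
def monoSpan (K : Type*) [Field K] {n : ℕ} (B : Set (Fin n → ℕ)) :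
    Submodule K (MvPolynomial (Fin n) K) :=
  Submodule.span K (mono K '' B)

theorem mono_mem_monoSpan {B : Set (Fin n → ℕ)} {w : Fin n → ℕ} (h : w ∈ B) :
    mono K w ∈ monoSpan K B := Submodule.subset_span ⟨w, h, rfl⟩

theorem monoSpan_mono {B B' : Set (Fin n → ℕ)} (h : B ⊆ B') :
    monoSpan K B ≤ monoSpan K B' := Submodule.span_mono (Set.image_mono h)

theorem monoSpan_le {B : Set (Fin n → ℕ)} {M : Submodule K (MvPolynomial (Fin n) K)}
    (h : ∀ w ∈ B, mono K w ∈ M) : monoSpan K B ≤ M :=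
  Submodule.span_le.2 (by rintro _ ⟨w, hw, rfl⟩; exact h w hw)

/-- The weights of the same degree and of smaller norm. -/
def inner (v : Fin n → ℕ) : Set (Fin n → ℕ) := {w | deg w = deg v ∧ nsq w < nsq v}

/-- `T_i` commutes with multiplication by the monomial `w'`, which is symmetric in `x_i, x_{i+1}`,
so only a power of `x_i` remains. The extra terms have their two exponents strictly between the
original ones, with the same sum, and hence a smaller sum of squares. -/
theorem heckeT_mono_of_lt (q : K) (i : Fin (n - 1)) {w : Fin n → ℕ} (h : w (hi i) < w (lo i)) :
    heckeT q i (mono K w) - mono K (w ∘ simple i) ∈ monoSpan K (inner w) := by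
  have hne := (lo_lt_hi i).ne
  obtain ⟨m, hm⟩ : ∃ m, w (lo i) = w (hi i) + (m + 1) := ⟨w (lo i) - w (hi i) - 1, by omega⟩
  set w' := Function.update w (lo i) (w (hi i)) with hw'
  have hlo : w' (lo i) = w (hi i) := by simp [hw']
  have hhi : w' (hi i) = w (hi i) := by simp [hw', hne.symm]
  have hw : w = w' + Pi.single (lo i) (m + 1) := by
    funext a
    by_cases ha : a = lo i
    · subst ha; simp [hlo, hm]
    · simp [hw', ha]
  have hsym : rename (simple i) (mono K w') = mono K w' := by
    rw [rename_mono, comp_simple_of_eq (hlo.trans hhi.symm)]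
  have hmw : mono K w = mono K w' * X (lo i) ^ (m + 1) := by
    conv_lhs => rw [hw]
    rw [mono_add, mono_single]
  have hmws : mono K (w ∘ simple i) = mono K w' * X (hi i) ^ (m + 1) := by
    rw [← rename_mono, hmw, map_mul, hsym, map_pow, rename_X, simple_lo]
  rw [hmws, hmw, heckeT_mul_of_rename_eq q i hsym, heckeT_X_pow, mul_add, add_sub_cancel_left,
    mul_smul_comm, Finset.mul_sum]
  refine Submodule.smul_mem _ _ (Submodule.sum_mem _ fun c hc => ?_)
  have hc' := Finset.mem_range.1 hc
  rw [← mono_single, ← mono_single, ← mul_assoc, ← mono_add, ← mono_add]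
  refine mono_mem_monoSpan ⟨?_, ?_⟩
  · rw [hw, deg_add_single, deg_add_single, deg_add_single]
    omega
  · rw [hw, nsq_add_single, nsq_add_single, nsq_add_single, hlo]
    have : (w' + Pi.single (lo i) (c + 1) : Fin n → ℕ) (hi i) = w (hi i) := by simp [hhi, hne.symm]
    rw [this]
    obtain ⟨d, rfl⟩ : ∃ d, m = c + (d + 1) := ⟨m - c - 1, by omega⟩
    rw [show c + (d + 1) - c = d + 1 by omega]
    nlinarith

theorem inner_comp_perm (v : Fin n → ℕ) (σ : Equiv.Perm (Fin n)) : inner (v ∘ σ) = inner v := by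
  simp only [inner, deg_comp_perm, nsq_comp_perm]

theorem heckeT_mono_mem (q : K) (i : Fin (n - 1)) (w : Fin n → ℕ) :
    heckeT q i (mono K w) ∈ monoSpan K ({w, w ∘ simple i} ∪ inner w) := by
  have h1 : mono K w ∈ monoSpan K ({w, w ∘ simple i} ∪ inner w) :=
    mono_mem_monoSpan (by simp)
  have h2 : mono K (w ∘ simple i) ∈ monoSpan K ({w, w ∘ simple i} ∪ inner w) :=
    mono_mem_monoSpan (by simp)
  have hle : monoSpan K (inner w) ≤ monoSpan K ({w, w ∘ simple i} ∪ inner w) :=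
    monoSpan_mono Set.subset_union_right
  rcases lt_trichotomy (w (lo i)) (w (hi i)) with h | h | h
  · have h3 := heckeT_mono_of_lt (K := K) q i (w := w ∘ simple i)
      (by simpa [simple_lo, simple_hi] using h)
    rw [inner_comp_perm, comp_simple_comp_simple] at h3
    -- `T_i` is multiplication by `q` on the orbit sum, which reduces an ascent to the descent `w
    -- s_i`.
    have h4 : heckeT q i (mono K w + mono K (w ∘ simple i)) =
        q • (mono K w + mono K (w ∘ simple i)) := by
      apply heckeT_of_rename_eq
      rw [map_add, rename_mono, rename_mono, comp_simple_comp_simple, add_comm]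
    have h5 : heckeT q i (mono K w) = q • (mono K w + mono K (w ∘ simple i)) -
        (heckeT q i (mono K (w ∘ simple i)) - mono K w) - mono K w := by
      rw [← h4, map_add]; ring
    rw [h5]
    exact sub_mem (sub_mem (Submodule.smul_mem _ _ (add_mem h1 h2)) (hle h3)) h1
  · rw [heckeT_of_rename_eq q i (by rw [rename_mono, comp_simple_of_eq h])]
    exact Submodule.smul_mem _ _ h1
  · have := add_mem (hle (heckeT_mono_of_lt (K := K) q i h)) h2
    rwa [sub_add_cancel] at this

/-- A set of weights is stable if it contains with a weight all those of the same degree and of at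
most the same norm. -/
def IsStable (B : Set (Fin n → ℕ)) : Prop :=
  ∀ w ∈ B, ∀ w', deg w' = deg w → nsq w' ≤ nsq w → w' ∈ B

theorem IsStable.heckeT_mem {B : Set (Fin n → ℕ)} (hB : IsStable B) (q : K) (i : Fin (n - 1))
    {f : MvPolynomial (Fin n) K} (hf : f ∈ monoSpan K B) : heckeT q i f ∈ monoSpan K B := by
  have : monoSpan K B ≤ (monoSpan K B).comap (heckeT q i) := by
    refine monoSpan_le fun w hw => monoSpan_mono ?_ (heckeT_mono_mem q i w)
    rintro w' ((rfl | rfl) | h)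
    · exact hw
    · exact hB _ hw _ (deg_comp_perm _ _) (nsq_comp_perm _ _).le
    · exact hB _ hw _ h.1 h.2.le
  exact this hf

theorem isStable_deg_nsq (d N : ℕ) : IsStable {w : Fin n → ℕ | deg w = d ∧ nsq w ≤ N} :=
  fun _ hw _ h1 h2 => ⟨h1.trans hw.1, h2.trans hw.2⟩

/-! ### The leading term of `U_v` -/

/-- The weights that may occur in `U_v` besides `v`. -/
def below (v : Fin n → ℕ) : Set (Fin n → ℕ) :=
  {w | deg w = deg v ∧ (nsq w < nsq v ∨ nsq w = nsq v ∧ length (zeta w) < length (zeta v))}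

theorem inner_subset_below (v : Fin n → ℕ) : inner v ⊆ below v := fun _ h => ⟨h.1, Or.inl h.2⟩

theorem length_zeta_comp_simple_le (w : Fin n → ℕ) (i : Fin (n - 1)) :
    length (zeta (w ∘ simple i)) ≤ length (zeta w) + 1 := by
  by_cases h : w (lo i) = w (hi i)
  · rw [comp_simple_of_eq h]; exact Nat.le_succ _
  · rw [zeta_comp_simple h]; exact length_mul_simple_le _ _

/-- The leading term moves from `v` to `v s_i`, and `ℓ(ζ)` grows by exactly one. For any other
weight of the same norm it grows by at most one, so that weight stays below. -/
theorem step_sub_mono_mem (q c : K) {v : Fin n → ℕ} {i : Fin (n - 1)} (h : v (hi i) < v (lo i))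
    {f : MvPolynomial (Fin n) K} (hf : f - mono K v ∈ monoSpan K (below v)) :
    heckeT q i f + c • f - mono K (v ∘ simple i) ∈ monoSpan K (below (v ∘ simple i)) := by
  have hlen : length (zeta (v ∘ simple i)) = length (zeta v) + 1 := by
    rw [zeta_comp_simple h.ne']
    exact length_mul_simple _ _ (zeta_lt_of_lt h)
  have hsub : below v ⊆ below (v ∘ simple i) := by
    rintro w ⟨h1, h2⟩
    refine ⟨by rw [h1, deg_comp_perm], ?_⟩
    rw [nsq_comp_perm, hlen]
    omega
  have h1 : heckeT q i (mono K v) - mono K (v ∘ simple i) ∈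
      monoSpan K (below (v ∘ simple i)) :=
    monoSpan_mono (inner_comp_perm v (simple i) ▸ inner_subset_below _)
      (heckeT_mono_of_lt q i h)
  have h2 : mono K v ∈ monoSpan K (below (v ∘ simple i)) := by
    refine mono_mem_monoSpan ⟨(deg_comp_perm _ _).symm, Or.inr ⟨(nsq_comp_perm _ _).symm, ?_⟩⟩
    omega
  have h3 : heckeT q i (f - mono K v) ∈ monoSpan K (below (v ∘ simple i)) := by
    have : monoSpan K (below v) ≤
        (monoSpan K (below (v ∘ simple i))).comap (heckeT q i) := by
      refine monoSpan_le fun w hw => monoSpan_mono ?_ (heckeT_mono_mem q i w)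
      rintro w' ((rfl | rfl) | hw')
      · exact hsub hw
      · refine ⟨by rw [deg_comp_perm, deg_comp_perm, hw.1], ?_⟩
        have := length_zeta_comp_simple_le w i
        rw [nsq_comp_perm, nsq_comp_perm, hlen]
        rcases hw.2 with h | h
        · exact Or.inl h
        · exact Or.inr ⟨h.1, by omega⟩
      · refine ⟨by rw [deg_comp_perm, hw'.1, hw.1], ?_⟩
        have := hw'.2
        rw [nsq_comp_perm]
        rcases hw.2 with h | h
        · exact Or.inl (this.trans h)
        · exact Or.inl (h.1 ▸ this)
    exact this hf
  have h4 := Submodule.smul_mem _ c (monoSpan_mono hsub hf)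
  have h5 := Submodule.smul_mem _ c h2
  have := add_mem (add_mem h1 h3) (add_mem h4 h5)
  convert this using 1
  rw [map_sub, smul_sub]
  ring

end Monomials

section KeyPolynomials

variable {K : Type*} [Field K] {n : ℕ} {q : K}

/-! ### The recursions for the `q`-Key polynomials -/

theorem U_comp_simple (hq0 : q ≠ 0) (hq : ∀ k, 0 < k → q ^ k ≠ 1) {v : Fin n → ℕ}
    {i : Fin (n - 1)} (h : v (hi i) < v (lo i)) :
    U q (v ∘ simple i) = heckeT q i (U q v) +
      cUp q ((zeta v (hi i) : ℕ) - zeta v (lo i)) • U q v := by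
  unfold U
  rw [dominant_comp_perm, zeta_comp_simple h.ne',
    yangBaxter_params_mul_simple hq0 hq _ _ (zeta_lt_of_lt h)]
  rfl

theorem UHat_comp_simple (hq0 : q ≠ 0) (hq : ∀ k, 0 < k → q ^ k ≠ 1) {v : Fin n → ℕ}
    {i : Fin (n - 1)} (h : v (hi i) < v (lo i)) :
    UHat q (v ∘ simple i) = heckeT q i (UHat q v) +
      (1 - q - cUp q ((eta v (hi i) : ℕ) - eta v (lo i))) • UHat q v := by
  unfold UHat
  rw [dominant_comp_perm, eta_comp_simple h.ne',
    yangBaxter_paramsRev_mul_simple hq0 hq _ _ (eta_lt_of_lt h)]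
  rfl

theorem UHat_of_antitone {v : Fin n → ℕ} (h : Antitone v) : UHat q v = mono K v := by
  rw [UHat, eta_of_antitone h, yangBaxter_one, dominant_of_antitone h]
  rfl

theorem cUp_one (hq : ∀ k, 0 < k → q ^ k ≠ 1) : cUp q 1 = 1 := by
  rw [cUp, pow_one, div_self]
  exact sub_ne_zero.2 fun h => hq 1 one_pos (by rw [pow_one, h])

/-- At distance one the scalar is `1`, so the last factor applied is `T_i + 1 = □_i`, whose image is
symmetric in `x_i, x_{i+1}`. -/
theorem rename_yangBaxter_of_eq (hq0 : q ≠ 0) (hq : ∀ k, 0 < k → q ^ k ≠ 1)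
    {σ : Equiv.Perm (Fin n)} {i : Fin (n - 1)} (h : (σ (lo i) : ℕ) = σ (hi i) + 1)
    (f : MvPolynomial (Fin n) K) :
    rename (simple i) (yangBaxter q (params q n) σ f) = yangBaxter q (params q n) σ f := by
  have h1 : (σ * simple i) (lo i) < (σ * simple i) (hi i) := by
    simp only [Equiv.Perm.mul_apply, simple_lo, simple_hi, Fin.lt_def]
    omega
  have h2 := yangBaxter_params_mul_simple hq0 hq _ _ h1
  rw [mul_simple_mul_simple] at h2
  simp only [Equiv.Perm.mul_apply, simple_lo, simple_hi, h, Nat.add_sub_cancel_left,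
    cUp_one hq, one_smul, heckeT, sub_add_cancel] at h2
  rw [h2]
  exact rename_square q i _

theorem heckeT_U_of_eq (hq0 : q ≠ 0) (hq : ∀ k, 0 < k → q ^ k ≠ 1) {v : Fin n → ℕ}
    {i : Fin (n - 1)} (h : v (lo i) = v (hi i)) : heckeT q i (U q v) = q • U q v :=
  heckeT_of_rename_eq q i (rename_yangBaxter_of_eq hq0 hq (zeta_of_eq h) _)

/-! ### The normalization -/

/-- The ratio `[k + 1]_q / [k]_q`. -/
def qRatio (q : K) (k : ℕ) : K := q + cUp q k

theorem qInt_one (hq : ∀ k, 0 < k → q ^ k ≠ 1) : qInt q 1 = 1 := by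
  rw [qInt, pow_one, div_self]
  exact sub_ne_zero.2 fun h => hq 1 one_pos (by rw [pow_one, h])

theorem qInt_ne_zero (hq : ∀ k, 0 < k → q ^ k ≠ 1) {k : ℕ} (hk : 0 < k) : qInt q k ≠ 0 := by
  refine div_ne_zero (sub_ne_zero.2 (hq k hk).symm) (sub_ne_zero.2 fun h => ?_)
  exact hq 1 one_pos (by rw [pow_one, h])

theorem qRatio_mul_qInt (hq : ∀ k, 0 < k → q ^ k ≠ 1) {k : ℕ} (hk : 0 < k) :
    qRatio q k * qInt q k = qInt q (k + 1) := by
  have h1 : 1 - q ^ k ≠ 0 := sub_ne_zero.2 (hq k hk).symm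
  have h2 : 1 - q ≠ 0 := sub_ne_zero.2 fun h => hq 1 one_pos (by rw [pow_one, h])
  unfold qRatio cUp qInt
  field_simp
  ring

/-- Along the stabilizer of `λ` each `T_i` that occurs fixes `x^λ` up to the factor `q`. A
Yang–Baxter factor at distance `k` thus acts by `q + (1-q)/(1-q^k)`, and each step contributes one
inversion. -/
theorem yangBaxter_mono (hq0 : q ≠ 0) (hq : ∀ k, 0 < k → q ^ k ≠ 1) {lam : Fin n → ℕ}
    (hl : Antitone lam) (σ : Equiv.Perm (Fin n)) (hσ : lam ∘ σ = lam) :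
    yangBaxter q (params q n) σ (mono K lam) =
      (∏ p ∈ inversions σ, qRatio q ((σ p.1 : ℕ) - σ p.2)) • mono K lam := by
  induction σ using perm_induction with
  | one =>
    rw [inversions_one, yangBaxter_one, Finset.prod_empty, one_smul]
    rfl
  | step σ i hi' ih =>
    have e1 : lam (σ (hi i)) = lam (lo i) := by
      have := congrFun hσ (lo i)
      simpa [simple_lo] using this
    have e2 : lam (σ (lo i)) = lam (hi i) := by
      have := congrFun hσ (hi i)
      simpa [simple_hi] using this
    have e3 : lam (lo i) = lam (hi i) :=
      -- Fixing `λ` forces equality: the ascent of `σ` and the inequality of positions compare the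
      -- two entries in opposite directions.
      le_antisymm (by rw [← e1, ← e2]; exact hl hi'.le) (hl (lo_lt_hi i).le)
    have hσ' : lam ∘ σ = lam := by
      calc lam ∘ σ = (lam ∘ (σ * simple i)) ∘ simple i := by funext a; simp
        _ = lam := by rw [hσ, comp_simple_of_eq e3]
    rw [yangBaxter_params_mul_simple hq0 hq σ i hi', Module.End.mul_apply, ih hσ', map_smul,
      inversions_mul_simple σ i hi', Finset.prod_cons, Finset.prod_map]
    simp only [pairSwap_apply, Equiv.Perm.mul_apply, simple_simple, simple_lo, simple_hi,
      LinearMap.add_apply, LinearMap.smul_apply, Module.End.one_apply]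
    rw [heckeT_of_rename_eq q i (by rw [rename_mono, comp_simple_of_eq e3]), ← add_smul,
      smul_smul, mul_comm]
    rfl

/-- The argument of `f` is the rank of `b` in `S`, which runs once through `1, …, |S|`. -/
theorem prod_rank {ι M : Type*} [LinearOrder ι] [CommMonoid M] (f : ℕ → M) (S : Finset ι) :
    ∏ b ∈ S, f ((S.filter fun a => a < b).card + 1) = ∏ j ∈ Finset.Icc 1 S.card, f j := by
  induction S using Finset.induction_on_max with
  | empty => simp
  | insert m S hm ih =>
    have hmS : m ∉ S := fun h => lt_irrefl _ (hm m h)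
    rw [Finset.prod_insert hmS, Finset.card_insert_of_notMem hmS,
      Finset.prod_Icc_succ_top (by omega), ← ih, mul_comm]
    congr 1
    · refine Finset.prod_congr rfl fun b hb => ?_
      rw [Finset.filter_insert, if_neg (hm b hb).le.not_gt]
    · congr 2
      rw [Finset.filter_insert, if_neg (lt_irrefl _), Finset.filter_true_of_mem hm]

theorem eq_Ico_of_upper {S : Finset ℕ} {b : ℕ} (h1 : ∀ x ∈ S, x < b)
    (h2 : ∀ x ∈ S, ∀ y, x ≤ y → y < b → y ∈ S) : S = Finset.Ico (b - S.card) b := by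
  rcases S.eq_empty_or_nonempty with rfl | hS
  · simp
  · have : S = Finset.Ico (S.min' hS) b := by
      ext x
      rw [Finset.mem_Ico]
      exact ⟨fun hx => ⟨S.min'_le x hx, h1 x hx⟩,
        fun hx => h2 _ (S.min'_mem hS) x hx.1 hx.2⟩
    have hlt := h1 _ (S.min'_mem hS)
    have hc : S.card = b - S.min' hS := by
      conv_lhs => rw [this]
      simp
    rw [hc, Nat.sub_sub_self hlt.le]
    exact this

theorem prod_qRatio_Ico (hq : ∀ k, 0 < k → q ^ k ≠ 1) (b c : ℕ) (h : c ≤ b) :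
    ∏ a ∈ Finset.Ico (b - c) b, qRatio q (b - a) = qInt q (c + 1) := by
  induction c with
  | zero => simp [qInt_one hq]
  | succ c ih =>
    rw [← Finset.insert_Ico_add_one_left_eq_Ico (by omega : b - (c + 1) < b),
      Finset.prod_insert (by simp), show b - (c + 1) + 1 = b - c by omega, ih (by omega),
      show b - (b - (c + 1)) = c + 1 by omega, qRatio_mul_qInt hq (Nat.succ_pos c)]

/-- As `λ` is monotone, the earlier positions with the same entry as `b` form an interval ending
just before `b`. The ratios over it telescope to `[r]_q`, with `r` the rank of `b` in its block;
grouping by blocks gives `d_λ`. -/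
theorem prod_qRatio_eq_dFactor (hq : ∀ k, 0 < k → q ^ k ≠ 1) {lam : Fin n → ℕ}
    (hl : Antitone lam) :
    ∏ b : Fin n, ∏ a ∈ Finset.univ.filter (fun a => a < b ∧ lam a = lam b),
      qRatio q ((b : ℕ) - a) = dFactor q lam := by
  have h1 : ∀ b : Fin n, ∏ a ∈ Finset.univ.filter (fun a => a < b ∧ lam a = lam b),
      qRatio q ((b : ℕ) - a) =
        qInt q ((Finset.univ.filter (fun a => a < b ∧ lam a = lam b)).card + 1) := by
    intro b
    set S := Finset.univ.filter (fun a : Fin n => a < b ∧ lam a = lam b) with hS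
    have hmem : ∀ a, a ∈ S ↔ a < b ∧ lam a = lam b := by simp [hS]
    have h2 : S.map Fin.valEmbedding = Finset.Ico ((b : ℕ) - S.card) b := by
      rw [← Finset.card_map Fin.valEmbedding]
      refine eq_Ico_of_upper ?_ ?_
      · simp only [Finset.mem_map, hmem, Fin.valEmbedding_apply]
        rintro x ⟨a, ⟨ha, -⟩, rfl⟩
        exact ha
      · simp only [Finset.mem_map, hmem, Fin.valEmbedding_apply]
        rintro x ⟨a, ⟨ha, hab⟩, rfl⟩ y hay hyb
        refine ⟨⟨y, hyb.trans b.2⟩, ⟨hyb, le_antisymm ?_ (hl hyb.le)⟩, rfl⟩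
        rw [← hab]
        exact hl hay
    have hc : S.card ≤ b := by
      have := congrArg Finset.card h2
      simp only [Finset.card_map, Nat.card_Ico] at this
      omega
    rw [← prod_qRatio_Ico hq b S.card hc, ← h2, Finset.prod_map]
    rfl
  simp only [h1]
  unfold dFactor
  rw [← Finset.prod_fiberwise_of_maps_to (s := Finset.univ) (t := Finset.univ.image lam) (g := lam)
    (fun x _ => Finset.mem_image_of_mem _ (Finset.mem_univ x))]
  refine Finset.prod_congr rfl fun a _ => ?_
  rw [← prod_rank]
  refine Finset.prod_congr rfl fun b hb => ?_
  congr 3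
  ext c
  simp only [Finset.mem_filter, Finset.mem_univ, true_and] at hb ⊢
  rw [hb]
  exact and_comm

theorem dFactor_ne_zero (hq : ∀ k, 0 < k → q ^ k ≠ 1) (lam : Fin n → ℕ) :
    dFactor q lam ≠ 0 :=
  Finset.prod_ne_zero_iff.2 fun _ _ => Finset.prod_ne_zero_iff.2 fun _ hj =>
    qInt_ne_zero hq (Finset.mem_Icc.1 hj).1

/-- `ζ(λ)` reverses each block of equal entries, so it carries its inversions bijectively to the
pairs of positions with equal entries. -/
theorem prod_inversions_zeta (hq : ∀ k, 0 < k → q ^ k ≠ 1) {lam : Fin n → ℕ}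
    (hl : Antitone lam) :
    ∏ p ∈ inversions (zeta lam), qRatio q ((zeta lam p.1 : ℕ) - zeta lam p.2) =
      dFactor q lam := by
  rw [← prod_qRatio_eq_dFactor hq hl]
  have hz := isZeta_zeta lam
  have hcomp : ∀ a, lam (zeta lam a) = lam a := fun a => by
    have := congrFun hz.comp a
    rwa [dominant_of_antitone hl] at this
  rw [Finset.prod_sigma']
  refine Finset.prod_bij (fun p _ => (⟨zeta lam p.1, zeta lam p.2⟩ : Σ _ : Fin n, Fin n)) ?_ ?_ ?_ ?_
  · intro p hp
    rw [mem_inversions] at hp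
    simp only [Finset.mem_sigma, Finset.mem_univ, Finset.mem_filter, true_and]
    refine ⟨hp.2, ?_⟩
    rw [hcomp, hcomp]
    refine le_antisymm (hl hp.1.le) ?_
    rw [← hcomp p.1, ← hcomp p.2]
    exact hl hp.2.le
  · intro p _ r _ h
    simp only [Sigma.mk.injEq, EmbeddingLike.apply_eq_iff_eq, heq_eq_eq] at h
    exact Prod.ext h.1 h.2
  · rintro ⟨b, a⟩ h
    simp only [Finset.mem_sigma, Finset.mem_univ, Finset.mem_filter, true_and] at h
    obtain ⟨x, rfl⟩ := (zeta lam).surjective b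
    obtain ⟨y, rfl⟩ := (zeta lam).surjective a
    refine ⟨(x, y), ?_, rfl⟩
    rw [mem_inversions]
    refine ⟨?_, h.1⟩
    rw [hcomp, hcomp] at h
    by_contra! hc
    rcases hc.lt_or_eq with hc | hc
    · exact absurd (hz.anti _ _ hc h.2) h.1.le.not_gt
    · change y = x at hc
      rw [hc] at h
      exact absurd h.1 (lt_irrefl _)
  · intro p _
    rfl

/-- The normalization by `d_λ` is chosen for this: it cancels the eigenvalue of `Y_{ζ(λ)}` on `x^λ`.
-/
theorem U_of_antitone (hq0 : q ≠ 0) (hq : ∀ k, 0 < k → q ^ k ≠ 1) {lam : Fin n → ℕ}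
    (hl : Antitone lam) : U q lam = mono K lam := by
  have hcomp : lam ∘ zeta lam = lam := by
    have := (isZeta_zeta lam).comp
    rwa [dominant_of_antitone hl] at this
  rw [U, dominant_of_antitone hl, map_smul, yangBaxter_mono hq0 hq hl _ hcomp,
    prod_inversions_zeta hq hl, smul_smul, inv_mul_cancel₀ (dFactor_ne_zero hq lam), one_smul]

theorem U_sub_mono_mem (hq0 : q ≠ 0) (hq : ∀ k, 0 < k → q ^ k ≠ 1) (v : Fin n → ℕ) :
    U q v - mono K v ∈ monoSpan K (below v) := by
  induction v using weight_induction with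
  | dom v h => rw [U_of_antitone hq0 hq h, sub_self]; exact zero_mem _
  | step v i h ih => rw [U_comp_simple hq0 hq h]; exact step_sub_mono_mem q _ h ih

theorem U_mem_monoSpan (hq0 : q ≠ 0) (hq : ∀ k, 0 < k → q ^ k ≠ 1) (v : Fin n → ℕ) :
    U q v ∈ monoSpan K {w | deg w = deg v ∧ nsq w ≤ nsq v} := by
  have h1 : mono K v ∈ monoSpan K {w : Fin n → ℕ | deg w = deg v ∧ nsq w ≤ nsq v} :=
    mono_mem_monoSpan ⟨rfl, le_rfl⟩
  have h2 := monoSpan_mono (K := K) (B' := {w | deg w = deg v ∧ nsq w ≤ nsq v})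
    (fun w hw => ⟨hw.1, hw.2.elim le_of_lt fun h => h.1.le⟩) (U_sub_mono_mem hq0 hq v)
  have := add_mem h2 h1
  rwa [sub_add_cancel] at this

theorem UHat_mem_monoSpan (hq0 : q ≠ 0) (hq : ∀ k, 0 < k → q ^ k ≠ 1) (v : Fin n → ℕ) :
    UHat q v ∈ monoSpan K {w | deg w = deg v ∧ nsq w ≤ nsq v} := by
  induction v using weight_induction with
  | dom v h => rw [UHat_of_antitone h]; exact mono_mem_monoSpan ⟨rfl, le_rfl⟩
  | step v i h ih =>
    rw [UHat_comp_simple hq0 hq h, deg_comp_perm, nsq_comp_perm]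
    exact add_mem ((isStable_deg_nsq _ _).heckeT_mem q i ih) (Submodule.smul_mem _ _ ih)

end KeyPolynomials

/-! ### Filtrations of the field of series -/

section Filtration

variable {K : Type*} [Field K] {n : ℕ}

/-- The monomial with exponent `e` as a series. -/
def xpow (K : Type*) [Field K] {n : ℕ} (e : Fin n → ℤ) : Series K n :=
  HahnSeries.single (toLex e) 1

theorem xpow_add (e e' : Fin n → ℤ) : xpow K (e + e') = xpow K e * xpow K e' := by
  rw [xpow, xpow, xpow, HahnSeries.single_mul_single, one_mul, toLex_add]

theorem xpow_zero : xpow K (0 : Fin n → ℤ) = 1 := rfl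

theorem xpow_neg (e : Fin n → ℤ) : xpow K (-e) = (xpow K e)⁻¹ := by
  refine eq_inv_of_mul_eq_one_left ?_
  rw [← xpow_add, neg_add_cancel, xpow_zero]

theorem coeff_xpow (e e' : Fin n → ℤ) :
    (xpow K e).coeff (toLex e') = if e' = e then 1 else 0 := by
  rw [xpow, HahnSeries.coeff_single]
  simp

theorem xpow_ne_zero (e : Fin n → ℤ) : xpow K e ≠ 0 :=
  HahnSeries.single_ne_zero one_ne_zero

/-- The series whose exponents `e` all satisfy `N ≤ φ e`. -/
def filt (K : Type*) [Field K] {n : ℕ} (φ : (Fin n → ℤ) →+ ℤ) (N : ℤ) :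
    Submodule K (Series K n) where
  carrier := {s | ∀ e, φ e < N → s.coeff (toLex e) = 0}
  add_mem' {a b} ha hb e he := by rw [HahnSeries.coeff_add, ha e he, hb e he, add_zero]
  zero_mem' _ _ := rfl
  smul_mem' c a ha e he := by rw [HahnSeries.coeff_smul, ha e he, smul_zero]

variable {φ : (Fin n → ℤ) →+ ℤ}

theorem filt_anti {N M : ℤ} (h : N ≤ M) {s : Series K n} (hs : s ∈ filt K φ M) :
    s ∈ filt K φ N := fun e he => hs e (he.trans_le h)

theorem filt_mul {N M : ℤ} {s t : Series K n} (hs : s ∈ filt K φ N) (ht : t ∈ filt K φ M) :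
    s * t ∈ filt K φ (N + M) := by
  intro e he
  rw [HahnSeries.coeff_mul]
  refine Finset.sum_eq_zero fun ij hij => ?_
  have h1 : ij.1 + ij.2 = toLex e := (Finset.mem_antidiagonal.1 hij).2.2
  have h2 : φ (ofLex ij.1) + φ (ofLex ij.2) = φ e := by
    rw [← map_add, ← ofLex_add, h1, ofLex_toLex]
  by_cases h : φ (ofLex ij.1) < N
  · have := hs _ h
    rw [toLex_ofLex] at this
    rw [this, zero_mul]
  · have := ht (ofLex ij.2) (by omega)
    rw [toLex_ofLex] at this
    rw [this, mul_zero]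

theorem xpow_mem_filt {N : ℤ} {e : Fin n → ℤ} (h : N ≤ φ e) : xpow K e ∈ filt K φ N := by
  intro e' he'
  rw [coeff_xpow, if_neg]
  rintro rfl
  omega

theorem one_mem_filt : (1 : Series K n) ∈ filt K φ 0 := by
  rw [← xpow_zero]
  exact xpow_mem_filt (by simp)

theorem C_mul_mem_filt {N : ℤ} (c : K) {s : Series K n} (hs : s ∈ filt K φ N) :
    HahnSeries.C c * s ∈ filt K φ N := by
  rw [HahnSeries.C_mul_eq_smul]
  exact Submodule.smul_mem _ _ hs

theorem pow_mem_filt {s : Series K n} {N : ℤ} (hs : s ∈ filt K φ N) (k : ℕ) :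
    s ^ k ∈ filt K φ (k * N) := by
  induction k with
  | zero => simpa using one_mem_filt
  | succ k ih =>
    rw [pow_succ]
    refine filt_anti (le_of_eq ?_) (filt_mul ih hs)
    push_cast; ring

theorem prod_mem_filt {ι : Type*} {S : Finset ι} {g : ι → Series K n}
    (h : ∀ p ∈ S, g p ∈ filt K φ 0) : ∏ p ∈ S, g p ∈ filt K φ 0 := by
  classical
  induction S using Finset.induction_on with
  | empty => exact one_mem_filt
  | insert a S ha ih =>
    rw [Finset.prod_insert ha]
    exact filt_mul (h a (Finset.mem_insert_self _ _))
      (ih fun p hp => h p (Finset.mem_insert_of_mem hp))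

theorem prod_sub_prod_mem_filt {ι : Type*} {S : Finset ι} {g t : ι → Series K n} {N : ℤ}
    (hg : ∀ p ∈ S, g p ∈ filt K φ 0) (ht : ∀ p ∈ S, t p ∈ filt K φ 0)
    (h : ∀ p ∈ S, g p - t p ∈ filt K φ N) : ∏ p ∈ S, g p - ∏ p ∈ S, t p ∈ filt K φ N := by
  classical
  induction S using Finset.induction_on with
  | empty => simp
  | insert a S ha ih =>
    rw [Finset.prod_insert ha, Finset.prod_insert ha]
    have h1 := filt_mul (h a (Finset.mem_insert_self _ _))
      (prod_mem_filt fun p hp => hg p (Finset.mem_insert_of_mem hp))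
    have h2 := filt_mul (ht a (Finset.mem_insert_self _ _))
      (ih (fun p hp => hg p (Finset.mem_insert_of_mem hp))
        (fun p hp => ht p (Finset.mem_insert_of_mem hp))
        (fun p hp => h p (Finset.mem_insert_of_mem hp)))
    rw [add_zero] at h1
    rw [zero_add] at h2
    have := add_mem h1 h2
    convert this using 1
    ring

theorem orderTop_C_mul_xpow (q : K) {e : Fin n → ℤ} (he : 0 < toLex e) :
    0 < (HahnSeries.C q * xpow K e).orderTop := by
  rw [xpow, HahnSeries.C_apply, HahnSeries.single_mul_single, zero_add]
  exact HahnSeries.lt_orderTop_single he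

theorem one_sub_ne_zero (q : K) {e : Fin n → ℤ} (he : 0 < toLex e) :
    1 - HahnSeries.C q * xpow K e ≠ 0 := fun h => by
  have := HahnSeries.SummableFamily.one_sub_self_mul_hsum_powers (orderTop_C_mul_xpow q he)
  rw [h, zero_mul] at this
  exact zero_ne_one this

/-- The inverse is the geometric series, each of whose powers lies in the filtration step; the sum
is computed coefficientwise. -/
theorem inv_one_sub_mem_filt (q : K) {e : Fin n → ℤ} (he : 0 < toLex e) (hφ : 0 ≤ φ e) :
    (1 - HahnSeries.C q * xpow K e)⁻¹ ∈ filt K φ 0 := by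
  have h := orderTop_C_mul_xpow q he
  rw [← eq_inv_of_mul_eq_one_right
    (HahnSeries.SummableFamily.one_sub_self_mul_hsum_powers h)]
  intro e' he'
  rw [HahnSeries.SummableFamily.coeff_hsum]
  refine finsum_eq_zero_of_forall_eq_zero fun k => ?_
  rw [HahnSeries.SummableFamily.powers_of_orderTop_pos h]
  have := pow_mem_filt (C_mul_mem_filt q (xpow_mem_filt (K := K) hφ)) k
  rw [mul_zero] at this
  exact this e' he'

/-! ### The kernel of the scalar product -/

/-- The root `e_a - e_b`. -/
def root (p : Fin n × Fin n) : Fin n → ℤ := Pi.single p.1 1 - Pi.single p.2 1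

theorem var_eq_xpow (a : Fin n) : var K a = xpow K (Pi.single a 1) := rfl

theorem var_div_var (a b : Fin n) : var K a / var K b = xpow K (root (a, b)) := by
  rw [var_eq_xpow, var_eq_xpow, div_eq_mul_inv, ← xpow_neg, ← xpow_add, root, sub_eq_add_neg]

theorem root_pos {p : Fin n × Fin n} (h : p.1 < p.2) : 0 < toLex (root p) := by
  refine ⟨p.1, fun j hj => ?_, ?_⟩
  · change (0 : ℤ) = root p j
    simp [root, hj.ne, (hj.trans h).ne]
  · change (0 : ℤ) < root p p.1
    simp [root, h.ne]

/-- The factor `(1 - x_a / x_b) / (1 - q x_a / x_b)` of `Θ`. -/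
def thetaFactor (q : K) (p : Fin n × Fin n) : Series K n :=
  (1 - xpow K (root p)) / (1 - HahnSeries.C q * xpow K (root p))

/-- The pairs of positions `a < b`. -/
def posPairs (n : ℕ) : Finset (Fin n × Fin n) := Finset.univ.filter fun p => p.1 < p.2

theorem mem_posPairs {p : Fin n × Fin n} : p ∈ posPairs n ↔ p.1 < p.2 := by simp [posPairs]

theorem Theta_eq (q : K) : Theta q n = ∏ p ∈ posPairs n, thetaFactor q p := by
  unfold Theta posPairs thetaFactor
  simp only [var_div_var]

theorem thetaFactor_mem_filt (q : K) {p : Fin n × Fin n} (h : p.1 < p.2)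
    (hφ : 0 ≤ φ (root p)) : thetaFactor q p ∈ filt K φ 0 := by
  rw [thetaFactor, div_eq_mul_inv]
  exact filt_mul (sub_mem one_mem_filt (xpow_mem_filt hφ))
    (inv_one_sub_mem_filt q (root_pos h) hφ)

/-- The truncation error is exactly the factor itself times `(q x_a/x_b)^N`. -/
theorem thetaFactor_sub_mem_filt (q : K) {p : Fin n × Fin n} (h : p.1 < p.2)
    (hφ : 1 ≤ φ (root p)) (N : ℕ) :
    thetaFactor q p - (1 - xpow K (root p)) *
      ∑ k ∈ Finset.range N, (HahnSeries.C q * xpow K (root p)) ^ k ∈ filt K φ N := by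
  have h0 : 0 ≤ φ (root p) := zero_le_one.trans hφ
  have h1 := one_sub_ne_zero q (root_pos h)
  have h2 := mul_neg_geom_sum (HahnSeries.C q * xpow K (root p)) N
  have h3 := pow_mem_filt (C_mul_mem_filt q (xpow_mem_filt (K := K) hφ)) N
  have h4 := filt_mul h3 (thetaFactor_mem_filt q h h0)
  rw [mul_one, add_zero] at h4
  convert h4 using 1
  rw [thetaFactor]
  generalize ∑ k ∈ Finset.range N, (HahnSeries.C q * xpow K (root p)) ^ k = S at h2 ⊢
  generalize (HahnSeries.C q * xpow K (root p)) ^ N = z at h2 ⊢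
  rw [div_sub' h1, mul_div_assoc']
  congr 1
  linear_combination -(1 - xpow K (root p)) * h2

/-- The pairing of exponents with a vector. -/
def pairing (ν : Fin n → ℤ) : (Fin n → ℤ) →+ ℤ where
  toFun e := ∑ j, ν j * e j
  map_zero' := by simp
  map_add' a b := by simp [mul_add, Finset.sum_add_distrib]

theorem pairing_apply (ν e : Fin n → ℤ) : pairing ν e = ∑ j, ν j * e j := rfl

theorem pairing_root (ν : Fin n → ℤ) (p : Fin n × Fin n) :
    pairing ν (root p) = ν p.1 - ν p.2 := by
  simp [pairing_apply, root, mul_sub, Finset.sum_sub_distrib, Pi.single_apply]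

/-- All exponents of `Θ` come from positive roots, on which a weakly decreasing vector is
nonnegative. The orthogonality of monomials uses this together with the constant term of `Θ`. -/
theorem Theta_mem_filt (q : K) {ν : Fin n → ℤ} (hν : Antitone ν) :
    Theta q n ∈ filt K (pairing ν) 0 := by
  rw [Theta_eq]
  refine prod_mem_filt fun p hp => ?_
  rw [mem_posPairs] at hp
  refine thetaFactor_mem_filt q hp ?_
  rw [pairing_root]
  exact sub_nonneg.2 (hν hp.le)

/-- A functional that is positive on the positive roots. -/
def height (n : ℕ) : (Fin n → ℤ) →+ ℤ := pairing fun j => -(j : ℤ)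

theorem one_le_height_root {p : Fin n × Fin n} (h : p.1 < p.2) : 1 ≤ height n (root p) := by
  rw [height, pairing_root]
  have : (p.1 : ℕ) < p.2 := h
  omega

/-- Modulo exponents of positive height `Θ` is `1`: truncation at `N = 1` leaves the numerators,
each of which is congruent to `1`. -/
theorem coeff_Theta_zero (q : K) : (Theta q n).coeff 0 = 1 := by
  have h : Theta q n - ∏ p ∈ posPairs n, (1 - xpow K (root p)) ∈ filt K (height n) 1 := by
    rw [Theta_eq]
    refine prod_sub_prod_mem_filt (fun p hp => ?_) (fun p hp => ?_) (fun p hp => ?_)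
    all_goals rw [mem_posPairs] at hp; have h1 := one_le_height_root hp
    · exact thetaFactor_mem_filt q hp (zero_le_one.trans h1)
    · exact sub_mem one_mem_filt (xpow_mem_filt (zero_le_one.trans h1))
    · simpa using thetaFactor_sub_mem_filt q hp h1 1
  have h' : ∏ p ∈ posPairs n, (1 - xpow K (root p)) - ∏ p ∈ posPairs n, 1 ∈
      filt K (height n) 1 := by
    refine prod_sub_prod_mem_filt (fun p hp => ?_) (fun p _ => one_mem_filt) (fun p hp => ?_)
    all_goals rw [mem_posPairs] at hp; have h1 := one_le_height_root hp
    · exact sub_mem one_mem_filt (xpow_mem_filt (zero_le_one.trans h1))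
    · rw [sub_sub_cancel_left]
      exact neg_mem (xpow_mem_filt h1)
  have h2 := add_mem h h' 0 (by simp)
  rw [sub_add_sub_cancel, Finset.prod_const_one, toLex_zero, HahnSeries.coeff_sub,
    HahnSeries.coeff_one, if_pos rfl, sub_eq_zero] at h2
  exact h2

/-! ### Laurent polynomials -/

/-- Laurent polynomials as series. -/
def laurent (K : Type*) [Field K] (n : ℕ) : AddMonoidAlgebra K (Fin n → ℤ) →ₐ[K] Series K n :=
  AddMonoidAlgebra.lift K (Series K n) (Fin n → ℤ)
    { toFun := fun e => xpow K e.toAdd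
      map_one' := xpow_zero
      map_mul' := fun _ _ => xpow_add _ _ }

theorem laurent_single (e : Fin n → ℤ) (c : K) :
    laurent K n (AddMonoidAlgebra.single e c) = c • xpow K e := by
  rw [laurent, AddMonoidAlgebra.lift_single]
  rfl

theorem coeff_laurent (a : AddMonoidAlgebra K (Fin n → ℤ)) (e : Fin n → ℤ) :
    (laurent K n a).coeff (toLex e) = a.coeff e := by
  induction a using AddMonoidAlgebra.induction_linear with
  | zero => simp
  | add f g hf hg => rw [map_add, HahnSeries.coeff_add, hf, hg]; rfl
  | single e' c =>
    rw [laurent_single, HahnSeries.coeff_smul, coeff_xpow, AddMonoidAlgebra.coeff_single,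
      Finsupp.single_apply]
    simp [eq_comm]

/-- The permutation of the variables of Laurent polynomials. -/
def laurentSwap (K : Type*) [Field K] {n : ℕ} (i : Fin (n - 1)) :
    AddMonoidAlgebra K (Fin n → ℤ) ≃ₐ[K] AddMonoidAlgebra K (Fin n → ℤ) :=
  AddMonoidAlgebra.domCongr K K
    { toFun := fun e => e ∘ simple i
      invFun := fun e => e ∘ simple i
      left_inv := fun e => comp_simple_comp_simple e i
      right_inv := fun e => comp_simple_comp_simple e i
      map_add' := fun _ _ => rfl }

theorem laurentSwap_single (i : Fin (n - 1)) (e : Fin n → ℤ) (c : K) :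
    laurentSwap K i (AddMonoidAlgebra.single e c) =
      AddMonoidAlgebra.single (e ∘ simple i) c :=
  AddMonoidAlgebra.domCongr_single ..

theorem laurentSwap_laurentSwap (i : Fin (n - 1)) (a : AddMonoidAlgebra K (Fin n → ℤ)) :
    laurentSwap K i (laurentSwap K i a) = a := by
  induction a using AddMonoidAlgebra.induction_linear with
  | zero => simp
  | add f g hf hg => rw [map_add, map_add, hf, hg]
  | single e c => rw [laurentSwap_single, laurentSwap_single, comp_simple_comp_simple]

theorem coeff_laurentSwap_zero (i : Fin (n - 1)) (a : AddMonoidAlgebra K (Fin n → ℤ)) :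
    (laurentSwap K i a).coeff 0 = a.coeff 0 := by
  rw [laurentSwap, AddMonoidAlgebra.coeff_domCongr, map_zero]

/-- The truncation of a factor of `Θ`. -/
def truncFactor (q : K) (N : ℕ) (p : Fin n × Fin n) : AddMonoidAlgebra K (Fin n → ℤ) :=
  (1 - AddMonoidAlgebra.single (root p) 1) *
    ∑ k ∈ Finset.range N, (AddMonoidAlgebra.single (root p) q) ^ k

theorem laurent_truncFactor (q : K) (N : ℕ) (p : Fin n × Fin n) :
    laurent K n (truncFactor q N p) = (1 - xpow K (root p)) *
      ∑ k ∈ Finset.range N, (HahnSeries.C q * xpow K (root p)) ^ k := by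
  simp only [truncFactor, map_mul, map_sub, map_one, map_sum, map_pow, laurent_single, one_smul,
    HahnSeries.C_mul_eq_smul]

theorem root_comp_simple (i : Fin (n - 1)) (p : Fin n × Fin n) :
    root p ∘ simple i = root (pairSwap i p) := by
  funext j
  have : ∀ a, (simple i j = a) = (j = simple i a) := fun a => by
    rw [eq_iff_iff]
    exact ⟨fun h => by rw [← h, simple_simple], fun h => by rw [h, simple_simple]⟩
  simp only [root, pairSwap_apply, Function.comp_apply, Pi.sub_apply, Pi.single_apply, this]

theorem laurentSwap_truncFactor (q : K) (N : ℕ) (i : Fin (n - 1)) (p : Fin n × Fin n) :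
    laurentSwap K i (truncFactor q N p) = truncFactor q N (pairSwap i p) := by
  simp only [truncFactor, map_mul, map_sub, map_one, map_sum, map_pow, laurentSwap_single,
    root_comp_simple]

/-- The transposition `s_i` permutes the positive roots other than `e_i - e_{i+1}`. -/
theorem laurentSwap_prod_truncFactor (q : K) (N : ℕ) (i : Fin (n - 1)) :
    laurentSwap K i (∏ p ∈ (posPairs n).erase (lo i, hi i), truncFactor q N p) =
      ∏ p ∈ (posPairs n).erase (lo i, hi i), truncFactor q N p := by
  have key : ∀ p ∈ (posPairs n).erase (lo i, hi i),
      pairSwap i p ∈ (posPairs n).erase (lo i, hi i) := by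
    intro p hp
    rw [Finset.mem_erase, mem_posPairs] at hp ⊢
    refine ⟨fun h => ?_, simple_lt_simple i hp.2 fun h => hp.1 (Prod.ext h.1 h.2)⟩
    have h1 : simple i p.1 = lo i := congrArg Prod.fst h
    have h2 : simple i p.2 = hi i := congrArg Prod.snd h
    have h3 : p.1 = hi i := by rw [← simple_simple i p.1, h1, simple_lo]
    have h4 : p.2 = lo i := by rw [← simple_simple i p.2, h2, simple_hi]
    have := hp.2
    rw [h3, h4] at this
    exact absurd this (lo_lt_hi i).le.not_gt
  have inv : ∀ p, pairSwap i (pairSwap i p) = p := fun p => by simp [pairSwap_apply]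
  simp only [map_prod, laurentSwap_truncFactor]
  exact Finset.prod_bij' (fun p _ => pairSwap i p) (fun p _ => pairSwap i p) key key
    (fun p _ => inv p) (fun p _ => inv p) (fun _ _ => rfl)

/-- The part of `Θ` that is symmetric in `x_i` and `x_{i+1}`. -/
def thetaSymm (q : K) (i : Fin (n - 1)) : Series K n :=
  ∏ p ∈ (posPairs n).erase (lo i, hi i), thetaFactor q p

theorem Theta_eq_mul (q : K) (i : Fin (n - 1)) :
    Theta q n = thetaFactor q (lo i, hi i) * thetaSymm q i := by
  rw [Theta_eq, thetaSymm, Finset.mul_prod_erase]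
  exact mem_posPairs.2 (lo_lt_hi i)

/-- Exchanging variables does not preserve the lexicographic order and does not act on series. For a
single monomial, however, the constant term sees only a truncation of the kernel, which is a Laurent
polynomial invariant under the exchange. -/
theorem coeff_laurent_mul_thetaSymm (q : K) (i : Fin (n - 1))
    (a : AddMonoidAlgebra K (Fin n → ℤ)) :
    (laurent K n (laurentSwap K i a) * thetaSymm q i).coeff 0 =
      (laurent K n a * thetaSymm q i).coeff 0 := by
  induction a using AddMonoidAlgebra.induction_linear with
  | zero => simp
  | add f g hf hg => simp only [map_add, add_mul, HahnSeries.coeff_add, hf, hg]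
  | single e c =>
    have trunc : ∀ (e : Fin n → ℤ) (N : ℕ), 0 < height n e + N →
        (laurent K n (AddMonoidAlgebra.single e c) * thetaSymm q i).coeff 0 =
          (AddMonoidAlgebra.single e c *
            ∏ p ∈ (posPairs n).erase (lo i, hi i), truncFactor q N p).coeff 0 := by
      intro e N hN
      rw [← coeff_laurent, map_mul, map_prod, toLex_zero, ← sub_eq_zero, ← HahnSeries.coeff_sub,
        ← mul_sub, laurent_single]
      refine filt_mul (φ := height n) (Submodule.smul_mem _ _ (xpow_mem_filt le_rfl))
        (prod_sub_prod_mem_filt (N := N) (fun p hp => ?_) (fun p hp => ?_) fun p hp => ?_) 0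
        (by simpa using hN)
      all_goals
        have hp' := mem_posPairs.1 (Finset.mem_of_mem_erase hp)
        have h1 := one_le_height_root hp'
        have h0 := zero_le_one.trans h1
      · exact thetaFactor_mem_filt q hp' h0
      · rw [laurent_truncFactor]
        refine filt_mul (N := 0) (M := 0) (sub_mem one_mem_filt (xpow_mem_filt h0))
          (sum_mem fun k _ => ?_)
        simpa using pow_mem_filt (C_mul_mem_filt q (xpow_mem_filt (K := K) h0)) k
      · rw [laurent_truncFactor]
        exact thetaFactor_sub_mem_filt q hp' h1 N
    -- One truncation order must serve for both the monomial and its image: the error starts at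
    -- height `height n e + N`, which has to be positive.
    obtain ⟨N, h1, h2⟩ : ∃ N : ℕ, 0 < height n e + N ∧ 0 < height n (e ∘ simple i) + N :=
      ⟨(height n e).natAbs + (height n (e ∘ simple i)).natAbs + 1, by omega, by omega⟩
    rw [laurentSwap_single, trunc _ N h2, trunc _ N h1, ← laurentSwap_single,
      ← laurentSwap_prod_truncFactor, ← map_mul, coeff_laurentSwap_zero]
    rw [laurentSwap_prod_truncFactor]

end Filtration

section Form

variable {K : Type*} [Field K] {n : ℕ}

/-! ### The operators are adjoint -/

/-- Polynomials as Laurent polynomials. -/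
def toLaurent (K : Type*) [Field K] (n : ℕ) :
    MvPolynomial (Fin n) K →ₐ[K] AddMonoidAlgebra K (Fin n → ℤ) :=
  aeval fun a => AddMonoidAlgebra.single (Pi.single a 1) 1

/-- The map `g ↦ g^♣` with values in Laurent polynomials. -/
def clubLaurent (K : Type*) [Field K] (n : ℕ) :
    MvPolynomial (Fin n) K →ₐ[K] AddMonoidAlgebra K (Fin n → ℤ) :=
  aeval fun a => AddMonoidAlgebra.single (-Pi.single (Fin.rev a) 1) 1

theorem laurent_toLaurent (f : MvPolynomial (Fin n) K) :
    laurent K n (toLaurent K n f) = toSeries K n f := by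
  have : (laurent K n).comp (toLaurent K n) = toSeries K n := by
    refine MvPolynomial.algHom_ext fun a => ?_
    simp [toLaurent, toSeries, laurent_single, var_eq_xpow]
  exact congrArg (fun g => g f) this

theorem laurent_clubLaurent (f : MvPolynomial (Fin n) K) :
    laurent K n (clubLaurent K n f) = club K n f := by
  have : (laurent K n).comp (clubLaurent K n) = club K n := by
    refine MvPolynomial.algHom_ext fun a => ?_
    simp [clubLaurent, club, laurent_single, var_eq_xpow, xpow_neg]
  exact congrArg (fun g => g f) this

theorem single_comp_simple (i : Fin (n - 1)) (a : Fin n) :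
    (Pi.single a 1 : Fin n → ℤ) ∘ simple i = Pi.single (simple i a) 1 := by
  funext j
  have : (simple i j = a) = (j = simple i a) := by
    rw [eq_iff_iff]
    exact ⟨fun h => by rw [← h, simple_simple], fun h => by rw [h, simple_simple]⟩
  simp only [Function.comp_apply, Pi.single_apply, this]

theorem toLaurent_rename (i : Fin (n - 1)) (f : MvPolynomial (Fin n) K) :
    toLaurent K n (rename (simple i) f) = laurentSwap K i (toLaurent K n f) := by
  have : (toLaurent K n).comp (rename (simple i)) =
      (laurentSwap K i).toAlgHom.comp (toLaurent K n) := by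
    refine MvPolynomial.algHom_ext fun a => ?_
    simp [toLaurent, laurentSwap_single, single_comp_simple]
  exact congrArg (fun g => g f) this

theorem clubLaurent_rename (i : Fin (n - 1)) (f : MvPolynomial (Fin n) K) :
    clubLaurent K n (rename (simple (Fin.rev i)) f) =
      laurentSwap K i (clubLaurent K n f) := by
  have : (clubLaurent K n).comp (rename (simple (Fin.rev i))) =
      (laurentSwap K i).toAlgHom.comp (clubLaurent K n) := by
    refine MvPolynomial.algHom_ext fun a => ?_
    have h1 : (-Pi.single (Fin.rev a) 1 : Fin n → ℤ) ∘ simple i =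
        -Pi.single (simple i (Fin.rev a)) 1 := by
      rw [← single_comp_simple]; rfl
    have h2 : Fin.rev (simple (Fin.rev i) a) = simple i (Fin.rev a) := by
      rw [← Fin.rev_rev a, simple_rev, Fin.rev_rev, Fin.rev_rev]
    simp [clubLaurent, laurentSwap_single, h1, h2]
  exact congrArg (fun g => g f) this

/-- With `a = x_i`, `b = x_{i+1}` and `G` the image of `F` under `T_i`, the factor of `Θ` cancels
the pole: what remains is the exchanged `F'` plus `F` times a multiplier depending only on `a`, `b`
and `q`. -/
theorem mul_thetaFactor_eq {L : Type*} [Field L] {q a b F F' G : L} (hb : b ≠ 0)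
    (hq : b - q * a ≠ 0)
    (h : (a - b) * G = (a - q * b) * F - (b - q * a) * F' - (a - b) * F) :
    G * ((1 - a / b) / (1 - q * (a / b))) = F' + F * ((q - 1) * b / (b - q * a)) := by
  have h1 : (1 - a / b) / (1 - q * (a / b)) = (b - a) / (b - q * a) := by
    rw [one_sub_div hb, mul_div_assoc', one_sub_div hb, div_div_div_cancel_right₀ hb]
  rw [h1, mul_div_assoc', mul_div_assoc', div_eq_iff hq, add_mul, div_mul_cancel₀ _ hq]
  linear_combination -h

theorem mul_heckeT (q : K) (i : Fin (n - 1)) (f : MvPolynomial (Fin n) K) :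
    (X (lo i) - X (hi i)) * heckeT q i f = (X (lo i) - C q * X (hi i)) * f
      - (X (hi i) - C q * X (lo i)) * rename (simple i) f - (X (lo i) - X (hi i)) * f := by
  have : heckeT q i f = square q i f - f := rfl
  rw [this, mul_sub, mul_square]

theorem var_ne_zero (a : Fin n) : var K a ≠ 0 := xpow_ne_zero _

theorem var_sub_mul_var_ne_zero (q : K) {a b : Fin n} (h : a < b) :
    var K b - HahnSeries.C q * var K a ≠ 0 := by
  have h1 := one_sub_ne_zero q (root_pos (p := (a, b)) h)
  rw [← var_div_var] at h1
  have h2 : var K b - HahnSeries.C q * var K a =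
      (1 - HahnSeries.C q * (var K a / var K b)) * var K b := by
    have := var_ne_zero (K := K) b
    field_simp
  rw [h2]
  exact mul_ne_zero h1 (var_ne_zero b)

theorem toSeries_C (c : K) : toSeries K n (C c) = HahnSeries.C c := by
  rw [toSeries, aeval_C]; rfl

theorem club_C (c : K) : club K n (C c) = HahnSeries.C c := by
  rw [club, aeval_C]; rfl

theorem form_apply (q : K) (f g : MvPolynomial (Fin n) K) :
    form q n f g = (toSeries K n f * club K n g * Theta q n).coeff 0 := rfl

/-- By `mul_thetaFactor_eq` both sides contain the same multiple of `f g^♣`. The remaining terms,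
`f^{s_i} g^♣` and its exchange in `x_i, x_{i+1}`, have equal constant terms against the symmetric
part of `Θ`. -/
theorem form_heckeT (q : K) (i : Fin (n - 1)) (f g : MvPolynomial (Fin n) K) :
    form q n (heckeT q i f) g = form q n f (heckeT q (Fin.rev i) g) := by
  have ha := var_ne_zero (K := K) (lo i)
  have hb := var_ne_zero (K := K) (hi i)
  have hqab := var_sub_mul_var_ne_zero q (lo_lt_hi i)
  have hΘ : thetaFactor q (lo i, hi i) = (1 - var K (lo i) / var K (hi i)) /
      (1 - HahnSeries.C q * (var K (lo i) / var K (hi i))) := by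
    rw [thetaFactor, var_div_var]
  have hf := congrArg (toSeries K n) (mul_heckeT q i f)
  have hg := congrArg (club K n) (mul_heckeT q (Fin.rev i) g)
  simp only [map_mul, map_sub, toSeries_C] at hf
  simp only [map_mul, map_sub, club_C] at hg
  simp only [toSeries, aeval_X] at hf
  simp only [club, aeval_X, lo_rev, hi_rev, Fin.rev_rev] at hg
  rw [← toSeries] at hf
  rw [← club] at hg
  have hf' := mul_thetaFactor_eq hb hqab hf
  -- `♣` both reverses the order of the variables and inverts them, so clearing denominators gives
  -- the same relation as for `f`.
  have hg' := mul_thetaFactor_eq (G := club K n (heckeT q (Fin.rev i) g))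
    (F := club K n g) (F' := club K n (rename (simple (Fin.rev i)) g)) hb hqab (by
      field_simp at hg
      linear_combination hg)
  rw [← hΘ] at hf' hg'
  have key : (toSeries K n (rename (simple i) f) * club K n g * thetaSymm q i).coeff 0 =
      (toSeries K n f * club K n (rename (simple (Fin.rev i)) g) * thetaSymm q i).coeff 0 := by
    have := coeff_laurent_mul_thetaSymm q i
      (laurentSwap K i (toLaurent K n f) * clubLaurent K n g)
    rw [map_mul, laurentSwap_laurentSwap, ← clubLaurent_rename, ← toLaurent_rename, map_mul,
      map_mul, laurent_toLaurent, laurent_toLaurent, laurent_clubLaurent,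
      laurent_clubLaurent] at this
    exact this.symm
  rw [form_apply, form_apply, Theta_eq_mul q i]
  have e1 : toSeries K n (heckeT q i f) * club K n g *
      (thetaFactor q (lo i, hi i) * thetaSymm q i) =
      toSeries K n (rename (simple i) f) * club K n g * thetaSymm q i +
        toSeries K n f * club K n g * ((HahnSeries.C q - 1) * var K (hi i) /
          (var K (hi i) - HahnSeries.C q * var K (lo i))) * thetaSymm q i := by
    linear_combination club K n g * thetaSymm q i * hf'
  have e2 : toSeries K n f * club K n (heckeT q (Fin.rev i) g) *
      (thetaFactor q (lo i, hi i) * thetaSymm q i) =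
      toSeries K n f * club K n (rename (simple (Fin.rev i)) g) * thetaSymm q i +
        toSeries K n f * club K n g * ((HahnSeries.C q - 1) * var K (hi i) /
          (var K (hi i) - HahnSeries.C q * var K (lo i))) * thetaSymm q i := by
    linear_combination toSeries K n f * thetaSymm q i * hg'
  rw [e1, e2, HahnSeries.coeff_add, HahnSeries.coeff_add, key]

/-! ### Values on monomials -/

/-- A weight as an exponent. -/
def toExp (w : Fin n → ℕ) : Fin n → ℤ := fun j => w j

theorem toSeries_mono (w : Fin n → ℕ) : toSeries K n (mono K w) = xpow K (toExp w) := by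
  have h : ∀ S : Finset (Fin n), ∏ j ∈ S, var K j ^ w j =
      xpow K (∑ j ∈ S, Pi.single j (w j : ℤ)) := by
    intro S
    classical
    induction S using Finset.induction_on with
    | empty => rfl
    | insert a S ha ih =>
      rw [Finset.prod_insert ha, Finset.sum_insert ha, xpow_add, ih]
      congr 1
      rw [var, HahnSeries.single_pow, one_pow, xpow]
      change HahnSeries.single (toLex (w a • (Pi.single a 1 : Fin n → ℤ))) 1 = _
      rw [← Pi.single_smul, nsmul_eq_mul, mul_one]
  simp only [mono, toSeries, map_prod, map_pow, aeval_X]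
  rw [h]
  congr 1
  exact Finset.univ_sum_single (toExp w)

theorem club_mono (w : Fin n → ℕ) :
    club K n (mono K w) = (xpow K (toExp (w ∘ Fin.rev)))⁻¹ := by
  rw [← toSeries_mono]
  simp only [mono, toSeries, club, map_prod, map_pow, aeval_X, inv_pow, Finset.prod_inv_distrib]
  congr 1
  rw [← Equiv.prod_comp Fin.revPerm]
  simp

theorem form_mono_mono (q : K) (w μ : Fin n → ℕ) :
    form q n (mono K w) (mono K μ) =
      (Theta q n).coeff (toLex (toExp (μ ∘ Fin.rev) - toExp w)) := by
  rw [form_apply, toSeries_mono, club_mono, ← xpow_neg, ← xpow_add, xpow,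
    HahnSeries.coeff_single_mul, one_mul, zero_sub, ← toLex_neg, neg_add_rev, neg_neg,
    ← sub_eq_add_neg]

theorem pairing_nonneg_of_coeff_ne_zero {q : K} {e ν : Fin n → ℤ} (hν : Antitone ν)
    (h : (Theta q n).coeff (toLex e) ≠ 0) : 0 ≤ ∑ j, ν j * e j := by
  by_contra! hc
  exact h (Theta_mem_filt q hν e hc)

theorem nsq_cast (w : Fin n → ℕ) : (nsq w : ℤ) = ∑ j, (w j : ℤ) ^ 2 := by
  simp [nsq]

theorem sum_sub_sq (v w : Fin n → ℕ) : ∑ j, ((v j : ℤ) - w j) ^ 2 =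
    nsq v - 2 * ∑ j, (v j : ℤ) * w j + nsq w := by
  rw [nsq_cast, nsq_cast, Finset.mul_sum, ← Finset.sum_sub_distrib, ← Finset.sum_add_distrib]
  exact Finset.sum_congr rfl fun j _ => by ring

/-- A nonzero value makes `μω - w` an exponent of `Θ`. Pairing it with the weakly decreasing vector
`-μω` gives `⟨μω, w⟩ ≥ |μ|²`; with `|w| ≤ |μ|` this yields `|μω - w|² ≤ 0`. -/
theorem form_mono_dominant (q : K) {w μ : Fin n → ℕ} (hμ : Antitone μ) (h : nsq w ≤ nsq μ) :
    form q n (mono K w) (mono K μ) = if w = μ ∘ Fin.rev then 1 else 0 := by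
  rw [form_mono_mono]
  split_ifs with hw
  · rw [hw, sub_self, toLex_zero, coeff_Theta_zero]
  · by_contra hne
    have h1 := pairing_nonneg_of_coeff_ne_zero
      (ν := fun j => -(μ (Fin.rev j) : ℤ)) (fun a b hab =>
        neg_le_neg (Int.ofNat_le.2 (antitone_comp_rev hμ hab))) hne
    have h2 : nsq (μ ∘ Fin.rev) = nsq μ := nsq_comp_perm μ Fin.revPerm
    have h3 := sum_sub_sq (μ ∘ Fin.rev) w
    have h4 : ∑ j, -(μ (Fin.rev j) : ℤ) * (toExp (μ ∘ Fin.rev) - toExp w) j =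
        ∑ j, ((μ ∘ Fin.rev) j : ℤ) * w j - nsq (μ ∘ Fin.rev) := by
      rw [nsq_cast, ← Finset.sum_sub_distrib]
      refine Finset.sum_congr rfl fun j _ => ?_
      simp only [toExp, Pi.sub_apply, Function.comp_apply]
      ring
    rw [h4, h2] at h1
    have h5 : ∑ j, (((μ ∘ Fin.rev) j : ℤ) - w j) ^ 2 = 0 := by
      refine le_antisymm ?_ (Finset.sum_nonneg fun j _ => sq_nonneg _)
      rw [h3, h2]
      have : (nsq w : ℤ) ≤ nsq μ := by exact_mod_cast h
      linarith
    rw [Finset.sum_eq_zero_iff_of_nonneg fun j _ => sq_nonneg _] at h5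
    refine hw (funext fun j => ?_)
    have := h5 j (Finset.mem_univ j)
    rw [sq_eq_zero_iff, sub_eq_zero] at this
    exact_mod_cast this.symm

/-- A nonzero value would give `⟨λ, wω⟩ ≥ |λ|²`, which is impossible when `|w| < |λ|`. -/
theorem form_dominant_mono (q : K) {w lam : Fin n → ℕ} (hl : Antitone lam)
    (h : nsq w < nsq lam) : form q n (mono K lam) (mono K w) = 0 := by
  rw [form_mono_mono]
  by_contra hne
  have h1 := pairing_nonneg_of_coeff_ne_zero (ν := toExp lam)
    (fun a b hab => Int.ofNat_le.2 (hl hab)) hne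
  have h2 : nsq (w ∘ Fin.rev) = nsq w := nsq_comp_perm w Fin.revPerm
  have h3 := sum_sub_sq lam (w ∘ Fin.rev)
  have h4 : ∑ j, toExp lam j * (toExp (w ∘ Fin.rev) - toExp lam) j =
      ∑ j, (lam j : ℤ) * (w ∘ Fin.rev) j - nsq lam := by
    rw [nsq_cast, ← Finset.sum_sub_distrib]
    refine Finset.sum_congr rfl fun j _ => ?_
    simp only [toExp, Pi.sub_apply]
    ring
  have h5 : 0 ≤ ∑ j, ((lam j : ℤ) - (w ∘ Fin.rev) j) ^ 2 := Finset.sum_nonneg fun j _ => sq_nonneg _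
  rw [h3, h2] at h5
  rw [h4] at h1
  have : (nsq w : ℤ) < nsq lam := by exact_mod_cast h
  linarith

end Form

section Duality

variable {K : Type*} [Field K] {n : ℕ} {q : K}

/-! ### Orthogonality -/

theorem form_of_mem_monoSpan {B : Set (Fin n → ℕ)} {f : MvPolynomial (Fin n) K}
    {φ : MvPolynomial (Fin n) K →ₗ[K] K} (h : ∀ w ∈ B, φ (mono K w) = 0) (hf : f ∈ monoSpan K B) :
    φ f = 0 :=
  monoSpan_le (M := LinearMap.ker φ) h hf

/-- The form with a fixed right argument. -/
def formLeft (q : K) (g : MvPolynomial (Fin n) K) : MvPolynomial (Fin n) K →ₗ[K] K where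
  toFun f := form q n f g
  map_add' f f' := by rw [map_add, LinearMap.add_apply]
  map_smul' c f := by rw [map_smul, LinearMap.smul_apply, RingHom.id_apply]

theorem formLeft_apply (f g : MvPolynomial (Fin n) K) : formLeft q g f = form q n f g := rfl

/-- `U_v` is orthogonal to the weights of smaller norm. -/
theorem form_U_of_nsq_lt (hq0 : q ≠ 0) (hq : ∀ k, 0 < k → q ^ k ≠ 1) (v : Fin n → ℕ)
    {B : Set (Fin n → ℕ)} (hB : IsStable B) (hlt : ∀ w ∈ B, nsq w < nsq v)
    {g : MvPolynomial (Fin n) K} (hg : g ∈ monoSpan K B) : form q n (U q v) g = 0 := by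
  induction v using weight_induction generalizing g with
  | dom v h =>
    rw [U_of_antitone hq0 hq h]
    exact form_of_mem_monoSpan (fun w hw => form_dominant_mono q h (hlt w hw)) hg
  -- The adjoint operator keeps `g` in the span because `B` is stable; hence the induction is over
  -- all `g` in the span, not over one monomial.
  | step v i h ih =>
    rw [nsq_comp_perm] at hlt
    rw [U_comp_simple hq0 hq h, map_add, map_smul, LinearMap.add_apply, LinearMap.smul_apply,
      ih hlt hg, form_heckeT, ih hlt (hB.heckeT_mem q _ hg), smul_zero, add_zero]

/-- If `|v| > |μ|`, this is orthogonality to smaller norms. Otherwise only the monomial `x^{μω}` of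
`U_v` can pair with `x^μ`, and `μω` is never strictly below `v`, since `ζ(μω)` is the longest
permutation. -/
theorem form_U_dominant (hq0 : q ≠ 0) (hq : ∀ k, 0 < k → q ^ k ≠ 1) (v : Fin n → ℕ)
    {μ : Fin n → ℕ} (hμ : Antitone μ) :
    form q n (U q v) (mono K μ) = if v = μ ∘ Fin.rev then 1 else 0 := by
  rcases lt_or_ge (nsq μ) (nsq v) with h | h
  · rw [form_U_of_nsq_lt hq0 hq v (B := {w | deg w = deg μ ∧ nsq w ≤ nsq μ})
      (isStable_deg_nsq _ _) (fun w hw => hw.2.trans_lt h) (mono_mem_monoSpan ⟨rfl, le_rfl⟩),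
      if_neg]
    rintro rfl
    exact h.ne (nsq_comp_perm μ Fin.revPerm).symm
  · have h1 : formLeft q (mono K μ) (U q v - mono K v) = 0 := by
      refine form_of_mem_monoSpan (fun w hw => ?_)
        (U_sub_mono_mem hq0 hq v)
      have hle : nsq w ≤ nsq μ := (hw.2.elim le_of_lt fun h => h.1.le).trans h
      rw [formLeft_apply, form_mono_dominant q hμ hle, if_neg]
      rintro rfl
      have e1 : nsq (μ ∘ Fin.rev) = nsq μ := nsq_comp_perm μ Fin.revPerm
      rcases hw.2 with h2 | ⟨-, h2⟩
      · omega
      · rw [zeta_of_monotone (antitone_comp_rev hμ)] at h2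
        refine absurd (Finset.card_le_card fun p hp => ?_) h2.not_ge
        rw [mem_inversions] at hp ⊢
        exact ⟨hp.1, Fin.rev_lt_rev.2 hp.1⟩
    rw [map_sub, sub_eq_zero, formLeft_apply, formLeft_apply] at h1
    rw [h1, form_mono_dominant q hμ h]

/-- Complementary scalars make the product of the two factors a scalar, so `T_i` on the upper member
of a pair `U_v, U_{v s_i}` is again a combination of both. -/
theorem heckeT_add_smul_add_smul (c : K) (i : Fin (n - 1)) (f : MvPolynomial (Fin n) K) :
    heckeT q i (heckeT q i f + c • f) + (1 - q - c) • (heckeT q i f + c • f) =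
      (q + c * (1 - q - c)) • f := by
  have h := LinearMap.congr_fun (heckeT_mul_self q i) f
  simp only [Module.End.mul_apply, LinearMap.add_apply, LinearMap.smul_apply,
    Module.End.one_apply] at h
  rw [map_add, map_smul, h]
  module

/-- The two families are adjoint. -/
theorem form_U_UHat (hq0 : q ≠ 0) (hq : ∀ k, 0 < k → q ^ k ≠ 1) (u v : Fin n → ℕ) :
    form q n (U q v) (UHat q u) = if v = u ∘ Fin.rev then 1 else 0 := by
  induction u using weight_induction generalizing v with
  | dom μ h => rw [UHat_of_antitone h, form_U_dominant hq0 hq v h]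
  | step u i hu ih =>
    rw [UHat_comp_simple hq0 hq hu, map_add, map_smul]
    set j := Fin.rev i with hj
    set c' := 1 - q - cUp q ((eta u (hi i) : ℕ) - eta u (lo i)) with hc'
    have hadj : form q n (U q v) (heckeT q i (UHat q u)) =
        form q n (heckeT q j (U q v)) (UHat q u) := by
      rw [form_heckeT, hj, Fin.rev_rev]
    rw [hadj, comp_simple_comp_rev, ← hj]
    have ulo : (u ∘ Fin.rev) (lo j) = u (hi i) := by
      rw [Function.comp_apply, hj, lo_rev, Fin.rev_rev]
    have uhi : (u ∘ Fin.rev) (hi j) = u (lo i) := by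
      rw [Function.comp_apply, hj, hi_rev, Fin.rev_rev]
    have slo : ((u ∘ Fin.rev) ∘ simple j) (lo j) = u (lo i) := by
      rw [Function.comp_apply, simple_lo, uhi]
    have shi : ((u ∘ Fin.rev) ∘ simple j) (hi j) = u (hi i) := by
      rw [Function.comp_apply, simple_hi, ulo]
    -- The operator `T_j` acts on the span of `U_v` and `U_{v s_j}`. Since `uω` has an ascent at
    -- `j`, a descent of `v` can meet only `uω s_j`, an ascent only `uω`, and equality neither.
    rcases lt_trichotomy (v (hi j)) (v (lo j)) with h | h | h
    · have hT : heckeT q j (U q v) = U q (v ∘ simple j) -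
          cUp q ((zeta v (hi j) : ℕ) - zeta v (lo j)) • U q v := by
        rw [U_comp_simple hq0 hq h, add_sub_cancel_right]
      have hne : v ≠ u ∘ Fin.rev := by
        rintro rfl
        rw [ulo, uhi] at h
        exact absurd hu h.le.not_gt
      rw [hT, map_sub, map_smul, LinearMap.sub_apply, LinearMap.smul_apply, ih, ih, if_neg hne,
        smul_zero, smul_zero, sub_zero, add_zero]
      refine if_congr ⟨fun e => ?_, fun e => ?_⟩ rfl rfl
      · rw [← e, comp_simple_comp_simple]
      · rw [e, comp_simple_comp_simple]
    · have hne : v ≠ u ∘ Fin.rev := by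
        rintro rfl
        rw [ulo, uhi] at h
        exact hu.ne' h
      have hne' : v ≠ (u ∘ Fin.rev) ∘ simple j := by
        rintro rfl
        rw [slo, shi] at h
        exact hu.ne h
      rw [heckeT_U_of_eq hq0 hq h.symm, map_smul, LinearMap.smul_apply, ih, if_neg hne,
        if_neg hne', smul_zero, smul_zero, add_zero]
    · have hne' : v ≠ (u ∘ Fin.rev) ∘ simple j := by
        rintro rfl
        rw [slo, shi] at h
        exact absurd hu h.le.not_gt
      have h' : (v ∘ simple j) (hi j) < (v ∘ simple j) (lo j) := by
        simpa [simple_lo, simple_hi] using h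
      have hU := U_comp_simple hq0 hq h'
      rw [comp_simple_comp_simple] at hU
      set c := cUp q ((zeta (v ∘ simple j) (hi j) : ℕ) - zeta (v ∘ simple j) (lo j)) with hc
      have hT : heckeT q j (U q v) =
          (q + c * (1 - q - c)) • U q (v ∘ simple j) - (1 - q - c) • U q v := by
        rw [← heckeT_add_smul_add_smul, ← hU, add_sub_cancel_right]
      have hne : v ∘ simple j ≠ u ∘ Fin.rev := by
        intro e
        rw [e, ulo, uhi] at h'
        exact absurd hu h'.le.not_gt
      rw [hT, map_sub, map_smul, map_smul, LinearMap.sub_apply, LinearMap.smul_apply,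
        LinearMap.smul_apply, ih, ih, if_neg hne, if_neg hne', smul_zero, zero_sub]
      split_ifs with e
      -- When `v = uω`, both recursions involve the same distance, and the coefficient `-(1-q-c)`
      -- from `T_j U_v` cancels `c'`.
      · have hz : eta u = zeta v * Fin.revPerm := by
          rw [← eta_comp_rev, e, Function.comp_assoc, Fin.rev_involutive.comp_self,
            Function.comp_id]
        have hcc : c = cUp q ((eta u (hi i) : ℕ) - eta u (lo i)) := by
          rw [hc, zeta_comp_simple h.ne, hz]
          simp only [Equiv.Perm.mul_apply, simple_lo, simple_hi, Fin.revPerm_apply]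
          rw [hj, lo_rev, hi_rev]
        rw [hc', hcc]
        simp
      · simp

theorem form_U_UHat_rev (hq0 : q ≠ 0) (hq : ∀ k, 0 < k → q ^ k ≠ 1) (u v : Fin n → ℕ) :
    form q n (U q v) (UHat q (u ∘ Fin.rev)) = if v = u then 1 else 0 := by
  rw [form_U_UHat hq0 hq, Function.comp_assoc, Fin.rev_involutive.comp_self, Function.comp_id]

theorem linearIndependent_U (hq0 : q ≠ 0) (hq : ∀ k, 0 < k → q ^ k ≠ 1) :
    LinearIndependent K (U q : (Fin n → ℕ) → MvPolynomial (Fin n) K) := by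
  rw [linearIndependent_iff']
  intro S g h v hv
  have := congrArg (fun f => form q n f (UHat q (v ∘ Fin.rev))) h
  simpa [map_sum, form_U_UHat_rev hq0 hq, hv] using this

theorem linearIndependent_UHat (hq0 : q ≠ 0) (hq : ∀ k, 0 < k → q ^ k ≠ 1) :
    LinearIndependent K (UHat q : (Fin n → ℕ) → MvPolynomial (Fin n) K) := by
  rw [linearIndependent_iff']
  intro S g h u hu
  have := congrArg (fun f => form q n (U q (u ∘ Fin.rev)) f) h
  have e : ∀ x : Fin n → ℕ, (u ∘ Fin.rev = x ∘ Fin.rev) = (u = x) := fun x => by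
    rw [eq_iff_iff, Fin.rev_surjective.injective_comp_right.eq_iff]
  simpa [map_sum, form_U_UHat hq0 hq, hu, e] using this

/-! ### Bases of the polynomial ring -/

theorem mono_linearIndependent : LinearIndependent K (mono K : (Fin n → ℕ) → _) := by
  have := (MvPolynomial.basisMonomials (Fin n) K).linearIndependent.comp
    Finsupp.equivFunOnFinite.symm Finsupp.equivFunOnFinite.symm.injective
  have e : (mono K : (Fin n → ℕ) → _) =
      MvPolynomial.basisMonomials (Fin n) K ∘ Finsupp.equivFunOnFinite.symm := by
    funext v
    simp [mono_eq_monomial]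
  rw [e]
  exact this

theorem span_mono_eq_top : Submodule.span K (Set.range (mono K : (Fin n → ℕ) → _)) = ⊤ := by
  rw [← (MvPolynomial.basisMonomials (Fin n) K).span_eq]
  congr 1
  ext f
  constructor
  · rintro ⟨v, rfl⟩
    exact ⟨Finsupp.equivFunOnFinite.symm v, by simp [mono_eq_monomial]⟩
  · rintro ⟨v, rfl⟩
    exact ⟨v, by simp [mono_eq_monomial]⟩

theorem finite_deg (d : ℕ) : {w : Fin n → ℕ | deg w = d}.Finite := by
  refine (Set.finite_Iic (fun _ : Fin n => d)).subset fun w hw j => ?_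
  have hw' : deg w = d := hw
  rw [← hw']
  exact Finset.single_le_sum (f := w) (fun _ _ => Nat.zero_le _) (Finset.mem_univ j)

/-- A linearly independent family of homogeneous polynomials that is indexed by the weights of its
members spans the polynomial ring. -/
theorem span_eq_top_of_linearIndependent {f : (Fin n → ℕ) → MvPolynomial (Fin n) K}
    (hf : LinearIndependent K f) (hdeg : ∀ v, f v ∈ monoSpan K {w | deg w = deg v}) :
    Submodule.span K (Set.range f) = ⊤ := by
  rw [eq_top_iff, ← span_mono_eq_top, Submodule.span_le]
  rintro _ ⟨v, rfl⟩
  set B : Set (Fin n → ℕ) := {w | deg w = deg v} with hB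
  have : Finite B := finite_deg (deg v)
  have : Fintype B := Fintype.ofFinite B
  have hfin : Module.Finite K (monoSpan K B) :=
    Module.Finite.span_of_finite K ((finite_deg (deg v)).image _)
  have h1 : Module.finrank K (monoSpan K B) = Fintype.card B := by
    have := finrank_span_eq_card (R := K)
      (mono_linearIndependent.comp (Subtype.val : B → _) Subtype.val_injective)
    rwa [Set.range_comp, Subtype.range_coe] at this
  -- In a fixed degree there are as many independent members of the family as monomials, so the
  -- inclusion of spans is an equality.
  have h2 : Submodule.span K (f '' B) = monoSpan K B := by
    refine Submodule.eq_of_le_of_finrank_eq (Submodule.span_le.2 ?_) ?_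
    · rintro _ ⟨w, hw, rfl⟩
      have := hdeg w
      rwa [show deg w = deg v from hw] at this
    · have := finrank_span_eq_card (R := K)
        (hf.comp (Subtype.val : B → _) Subtype.val_injective)
      rw [Set.range_comp, Subtype.range_coe] at this
      rw [h1, this]
  have h3 : mono K v ∈ monoSpan K B := mono_mem_monoSpan rfl
  rw [← h2] at h3
  exact Submodule.span_mono (Set.image_subset_range _ _) h3

theorem span_U (hq0 : q ≠ 0) (hq : ∀ k, 0 < k → q ^ k ≠ 1) :
    Submodule.span K (Set.range (U q : (Fin n → ℕ) → MvPolynomial (Fin n) K)) = ⊤ :=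
  span_eq_top_of_linearIndependent (linearIndependent_U hq0 hq) fun v =>
    monoSpan_mono (fun _ hw => hw.1) (U_mem_monoSpan hq0 hq v)

theorem span_UHat (hq0 : q ≠ 0) (hq : ∀ k, 0 < k → q ^ k ≠ 1) :
    Submodule.span K (Set.range (UHat q : (Fin n → ℕ) → MvPolynomial (Fin n) K)) = ⊤ :=
  span_eq_top_of_linearIndependent (linearIndependent_UHat hq0 hq) fun v =>
    monoSpan_mono (fun _ hw => hw.1) (UHat_mem_monoSpan hq0 hq v)

/-- The basis of the `U_v`. -/
def basisU (hq0 : q ≠ 0) (hq : ∀ k, 0 < k → q ^ k ≠ 1) :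
    Module.Basis (Fin n → ℕ) K (MvPolynomial (Fin n) K) :=
  Module.Basis.mk (linearIndependent_U hq0 hq) (span_U hq0 hq).ge

/-- The basis of the `Û_v`. -/
def basisUHat (hq0 : q ≠ 0) (hq : ∀ k, 0 < k → q ^ k ≠ 1) :
    Module.Basis (Fin n → ℕ) K (MvPolynomial (Fin n) K) :=
  Module.Basis.mk (linearIndependent_UHat hq0 hq) (span_UHat hq0 hq).ge

theorem basisU_apply (hq0 : q ≠ 0) (hq : ∀ k, 0 < k → q ^ k ≠ 1) (v : Fin n → ℕ) :
    basisU hq0 hq v = U q v := Module.Basis.mk_apply _ _ v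

theorem basisUHat_apply (hq0 : q ≠ 0) (hq : ∀ k, 0 < k → q ^ k ≠ 1) (v : Fin n → ℕ) :
    basisUHat hq0 hq v = UHat q v := Module.Basis.mk_apply _ _ v

theorem basisU_repr (hq0 : q ≠ 0) (hq : ∀ k, 0 < k → q ^ k ≠ 1)
    (f : MvPolynomial (Fin n) K) (v : Fin n → ℕ) :
    (basisU hq0 hq).repr f v = form q n f (UHat q (v ∘ Fin.rev)) := by
  have : (Finsupp.lapply v).comp (basisU (n := n) hq0 hq).repr.toLinearMap =
      formLeft q (UHat q (v ∘ Fin.rev)) := by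
    refine (basisU hq0 hq).ext fun w => ?_
    rw [LinearMap.comp_apply, LinearEquiv.coe_coe, Module.Basis.repr_self, formLeft_apply,
      basisU_apply, form_U_UHat_rev hq0 hq, Finsupp.lapply_apply, Finsupp.single_apply]
  exact LinearMap.congr_fun this f

end Duality

/-! ### Hall-Littlewood polynomials -/

section HallLittlewood

variable {K : Type*} [Field K] {n : ℕ} {q : K}

theorem rename_of_forall_simple {f : MvPolynomial (Fin n) K}
    (h : ∀ i : Fin (n - 1), rename (simple i) f = f) (σ : Equiv.Perm (Fin n)) :
    rename σ f = f := by
  induction σ using perm_induction with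
  | one => exact rename_id_apply f
  | step σ i _ ih =>
    rw [Equiv.Perm.coe_mul, ← rename_rename, h, ih]

theorem rename_yangBaxter_revPerm (hq0 : q ≠ 0) (hq : ∀ k, 0 < k → q ^ k ≠ 1)
    (f : MvPolynomial (Fin n) K) (i : Fin (n - 1)) :
    rename (simple i) (yangBaxter q (params q n) Fin.revPerm f) =
      yangBaxter q (params q n) Fin.revPerm f := by
  refine rename_yangBaxter_of_eq hq0 hq ?_ f
  simp only [Fin.revPerm_apply, Fin.val_rev, lo, hi]
  omega

theorem permFrac_one (x : FractionRing (MvPolynomial (Fin n) K)) : permFrac K 1 x = x := by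
  have : permFrac K (1 : Equiv.Perm (Fin n)) = RingHom.id _ := by
    refine IsLocalization.ringHom_ext (nonZeroDivisors (MvPolynomial (Fin n) K)) ?_
    refine RingHom.ext fun f => ?_
    rw [RingHom.comp_apply, permFrac_algebraMap]
    exact congrArg _ (rename_id_apply f)
  rw [this, RingHom.id_apply]

/-- Distinct permutations of the variables are linearly independent. -/
theorem permFrac_coeff_ext {R R' : Equiv.Perm (Fin n) → FractionRing (MvPolynomial (Fin n) K)}
    (h : ∀ f : MvPolynomial (Fin n) K, ∑ w, R w * permFrac K w (algebraMap _ _ f) =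
      ∑ w, R' w * permFrac K w (algebraMap _ _ f)) : R = R' := by
  let χ : Equiv.Perm (Fin n) → MvPolynomial (Fin n) K →* FractionRing (MvPolynomial (Fin n) K) :=
    fun w => ((permFrac K w).comp (algebraMap _ _)).toMonoidHom
  have hχ : ∀ w f, χ w f = permFrac K w (algebraMap _ _ f) := fun _ _ => rfl
  have inj : Function.Injective χ := by
    intro w w' hw
    ext1 a
    have := DFunLike.congr_fun hw (X a)
    rw [hχ, hχ, ← ratVar, permFrac_ratVar, permFrac_ratVar] at this
    exact ratVar_injective this
  -- Dedekind's independence of characters, applied to the distinct multiplicative maps `f ↦ w f`.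
  have li := (linearIndependent_monoidHom (MvPolynomial (Fin n) K)
    (FractionRing (MvPolynomial (Fin n) K))).comp χ inj
  have := Fintype.linearIndependent_iff.1 li (fun w => R w - R' w) (by
    funext f
    simp only [Finset.sum_apply, Pi.smul_apply, Function.comp_apply, smul_eq_mul, sub_mul, hχ,
      Finset.sum_sub_distrib, h f, sub_self, Pi.zero_apply])
  exact funext fun w => sub_eq_zero.1 (this w)

/-- The operators `Y_σ` are combinations of permutations of length at most `ℓ(σ)`, and the
coefficient of the permutation of maximal length is a product over the inversions. -/
theorem exists_expansion (hq0 : q ≠ 0) (hq : ∀ k, 0 < k → q ^ k ≠ 1)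
    (σ : Equiv.Perm (Fin n)) :
    ∃ R : Equiv.Perm (Fin n) → FractionRing (MvPolynomial (Fin n) K),
      (∀ f, algebraMap _ _ (yangBaxter q (params q n) σ f) =
        ∑ w, R w * permFrac K w (algebraMap _ _ f)) ∧
      (∀ w, length σ < length w⁻¹ → R w = 0) ∧
      R σ⁻¹ = ∏ p ∈ inversions σ, (ratVar K p.2 - ratC K n q * ratVar K p.1) /
        (ratVar K p.2 - ratVar K p.1) := by
  induction σ using perm_induction with
  | one =>
    refine ⟨fun w => if w = 1 then 1 else 0, fun f => ?_, fun w hw => if_neg ?_, ?_⟩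
    · rw [yangBaxter_one]
      simp [permFrac_one]
    · rintro rfl
      rw [inv_one] at hw
      exact lt_irrefl _ hw
    · rw [inversions_one, Finset.prod_empty]
      exact if_pos inv_one
  | step σ i hσ ih =>
    obtain ⟨R, h1, h2, h3⟩ := ih
    have hinv : (simple i)⁻¹ = simple i := Equiv.swap_inv _ _
    have hx := ratVar_sub_ne_zero (K := K) (lo_lt_hi i).ne
    set c := cUp q ((σ (hi i) : ℕ) - σ (lo i)) with hc
    -- The Yang–Baxter factor is `A + B s_i`. It is applied after `Y_σ`, so `s_i` multiplies the
    -- permutations from the left; this is why inverses of `σ` occur.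
    set A := (ratVar K (lo i) - ratC K n q * ratVar K (hi i)) /
      (ratVar K (lo i) - ratVar K (hi i)) - 1 + ratC K n c with hA
    set B := (ratVar K (hi i) - ratC K n q * ratVar K (lo i)) /
      (ratVar K (hi i) - ratVar K (lo i)) with hB
    refine ⟨fun w => A * R w + B * permFrac K (simple i) (R (simple i * w)), fun f => ?_,
      fun w hw => ?_, ?_⟩
    · have e1 : ∑ w, B * permFrac K (simple i) (R (simple i * w)) *
          permFrac K w (algebraMap _ _ f) = B * permFrac K (simple i)
            (∑ w, R w * permFrac K w (algebraMap _ _ f)) := by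
        rw [map_sum, Finset.mul_sum, ← Equiv.sum_comp (Equiv.mulLeft (simple i))]
        refine Finset.sum_congr rfl fun w _ => ?_
        rw [Equiv.coe_mulLeft, ← mul_assoc, simple_mul_self, one_mul, map_mul, permFrac_permFrac,
          mul_assoc]
      simp only [add_mul, Finset.sum_add_distrib]
      rw [e1, ← h1]
      simp only [mul_assoc]
      rw [← Finset.mul_sum, ← h1, yangBaxter_params_mul_simple hq0 hq σ i hσ,
        Module.End.mul_apply, LinearMap.add_apply, LinearMap.smul_apply, Module.End.one_apply,
        map_add, algebraMap_heckeT, smul_eq_C_mul, map_mul, ← hc, ← ratC, hA, hB]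
      generalize algebraMap _ (FractionRing (MvPolynomial (Fin n) K))
        (yangBaxter q (params q n) σ f) = G
      rw [← neg_sub (ratVar K (lo i)) (ratVar K (hi i))]
      field_simp
      ring
    · rw [length_mul_simple σ i hσ] at hw
      have e : length (simple i * w)⁻¹ + 1 ≥ length w⁻¹ := by
        have := length_mul_simple_le ((simple i * w)⁻¹) i
        rw [mul_inv_rev, hinv, mul_simple_mul_simple] at this
        rwa [mul_inv_rev, hinv]
      beta_reduce
      rw [h2 w (by omega), h2 (simple i * w) (by omega), map_zero, mul_zero, mul_zero, add_zero]
    · have e1 : (σ * simple i)⁻¹ = simple i * σ⁻¹ := by rw [mul_inv_rev, hinv]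
      -- The inverse of this permutation is longer than `σ`, so the top coefficient comes only from
      -- the `B` term.
      have e2 : R (simple i * σ⁻¹) = 0 := by
        refine h2 _ ?_
        rw [← e1, inv_inv, length_mul_simple σ i hσ]
        exact Nat.lt_succ_self _
      beta_reduce
      rw [e1, e2, ← mul_assoc, simple_mul_self, one_mul, h3, mul_zero, zero_add,
        inversions_mul_simple σ i hσ, Finset.prod_cons, Finset.prod_map, map_prod]
      simp only [map_div₀, map_sub, map_mul, permFrac_ratVar, permFrac_ratC, pairSwap_apply]
      rw [hB]

/-- The operator `Y_ω` is the symmetrization of the Hall-Littlewood kernel. -/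
theorem algebraMap_yangBaxter_revPerm (hq0 : q ≠ 0) (hq : ∀ k, 0 < k → q ^ k ≠ 1)
    (f : MvPolynomial (Fin n) K) :
    algebraMap _ (FractionRing (MvPolynomial (Fin n) K))
      (yangBaxter q (params q n) Fin.revPerm f) =
      ∑ w : Equiv.Perm (Fin n), permFrac K w (algebraMap _ _ f) *
        ∏ p ∈ posPairs n, (ratVar K (w p.1) - ratC K n q * ratVar K (w p.2)) /
          (ratVar K (w p.1) - ratVar K (w p.2)) := by
  obtain ⟨R, h1, -, h3⟩ := exists_expansion (n := n) hq0 hq Fin.revPerm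
  have hinv : ∀ i : Fin (n - 1), (simple i)⁻¹ = simple i := fun i => Equiv.swap_inv _ _
  -- Applying `s_i` to the symmetric image of `Y_ω` gives a second expansion, and uniqueness of
  -- coefficients identifies the two.
  have hsymm : ∀ (i : Fin (n - 1)) (w : Equiv.Perm (Fin n)),
      R (simple i * w) = permFrac K (simple i) (R w) := by
    intro i w
    have : R = fun w => permFrac K (simple i) (R (simple i * w)) := by
      refine permFrac_coeff_ext fun f => ?_
      rw [← h1, ← rename_yangBaxter_revPerm hq0 hq f i, ← permFrac_algebraMap, h1, map_sum,
        ← Equiv.sum_comp (Equiv.mulLeft (simple i))]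
      refine Finset.sum_congr rfl fun w _ => ?_
      rw [Equiv.coe_mulLeft, map_mul, permFrac_permFrac, ← mul_assoc, simple_mul_self, one_mul]
    rw [this]
    simp only
    rw [← mul_assoc, simple_mul_self, one_mul]
    exact congrArg _ (congrFun this w)
  have hR : ∀ w, R w = permFrac K w (R 1) := by
    have : ∀ σ : Equiv.Perm (Fin n), R σ⁻¹ = permFrac K σ⁻¹ (R 1) := by
      intro σ
      induction σ using perm_induction with
      | one => rw [inv_one, permFrac_one]
      | step σ i _ ih =>
        rw [mul_inv_rev, hinv, hsymm, ih, permFrac_permFrac]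
    intro w
    simpa using this w⁻¹
  have hrev : (Fin.revPerm : Equiv.Perm (Fin n))⁻¹ = Fin.revPerm := rfl
  have hrr : (Fin.revPerm : Equiv.Perm (Fin n)) * Fin.revPerm = 1 := by
    ext1 a
    simp
  -- The known coefficient is that of `ω`; applying `ω` to it reverses the variables and turns its
  -- inversions into the pairs `i < j`.
  have hone : R 1 = ∏ p ∈ posPairs n, (ratVar K p.1 - ratC K n q * ratVar K p.2) /
      (ratVar K p.1 - ratVar K p.2) := by
    have e : R 1 = permFrac K Fin.revPerm (R Fin.revPerm) := by
      rw [hR Fin.revPerm, permFrac_permFrac, hrr, permFrac_one]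
    rw [hrev] at h3
    rw [e, h3, map_prod]
    simp only [map_div₀, map_sub, map_mul, permFrac_ratVar, permFrac_ratC, Fin.revPerm_apply]
    refine Finset.prod_bij' (fun p _ => (Fin.rev p.2, Fin.rev p.1))
      (fun p _ => (Fin.rev p.2, Fin.rev p.1)) ?_ ?_ ?_ ?_ ?_
    · intro p hp
      exact mem_posPairs.2 (Fin.rev_lt_rev.2 (mem_inversions.1 hp).1)
    · intro p hp
      have := mem_posPairs.1 hp
      exact mem_inversions.2 ⟨Fin.rev_lt_rev.2 this, by simpa using this⟩
    · intro p _; simp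
    · intro p _; simp
    · intro p _; rfl
  rw [h1]
  refine Finset.sum_congr rfl fun w _ => ?_
  rw [hR, hone, mul_comm, map_prod]
  simp only [map_div₀, map_sub, map_mul, permFrac_ratVar, permFrac_ratC]

theorem algebraMap_U_comp_rev (hq0 : q ≠ 0) (hq : ∀ k, 0 < k → q ^ k ≠ 1) {lam : Fin n → ℕ}
    (hl : Antitone lam) :
    algebraMap _ (FractionRing (MvPolynomial (Fin n) K)) (U q (lam ∘ Fin.rev)) =
      hallLittlewood q lam := by
  rw [U, zeta_of_monotone (antitone_comp_rev hl), dominant_comp_rev, dominant_of_antitone hl,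
    map_smul, smul_eq_C_mul, map_mul, algebraMap_yangBaxter_revPerm hq0 hq, hallLittlewood]
  congr 1
  refine Finset.sum_congr rfl fun w _ => ?_
  congr 1
  simp only [mono, map_prod, map_pow, ← permFrac_ratVar]
  rfl

theorem U_comp_rev_mem (hq0 : q ≠ 0) (hq : ∀ k, 0 < k → q ^ k ≠ 1) {lam : Fin n → ℕ}
    (hl : Antitone lam) : U q (lam ∘ Fin.rev) ∈ symmetricSubalgebra (Fin n) K := by
  rw [mem_symmetricSubalgebra]
  refine rename_of_forall_simple fun i => ?_
  rw [U, zeta_of_monotone (antitone_comp_rev hl)]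
  exact rename_yangBaxter_revPerm hq0 hq _ i

/-- A symmetric `f` satisfies `T_i f = q f`, so each step of the recursion for `Û` multiplies the
pairing with `f` by a scalar. -/
theorem form_UHat_eq_zero (hq0 : q ≠ 0) (hq : ∀ k, 0 < k → q ^ k ≠ 1)
    {f : MvPolynomial (Fin n) K} (hf : f ∈ symmetricSubalgebra (Fin n) K)
    (h : ∀ μ, Antitone μ → form q n f (UHat q μ) = 0) (u : Fin n → ℕ) :
    form q n f (UHat q u) = 0 := by
  induction u using weight_induction with
  | dom u hu => exact h u hu
  | step u i hu ih =>
    have e : form q n f (heckeT q i (UHat q u)) =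
        form q n (heckeT q (Fin.rev i) f) (UHat q u) := by
      rw [form_heckeT, Fin.rev_rev]
    rw [UHat_comp_simple hq0 hq hu, map_add, map_smul, e,
      heckeT_of_rename_eq q _ ((mem_symmetricSubalgebra f).1 hf _), map_smul,
      LinearMap.smul_apply, ih, smul_zero, smul_zero, add_zero]

/-- Subtracting from `f` its components along the `U_v` with `v` weakly increasing leaves a
symmetric polynomial orthogonal to all dominant `Û_μ`. It is then orthogonal to every `Û_u`, so all
its coordinates vanish. -/
theorem mem_span_U_comp_rev (hq0 : q ≠ 0) (hq : ∀ k, 0 < k → q ^ k ≠ 1)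
    {f : MvPolynomial (Fin n) K} (hf : f ∈ symmetricSubalgebra (Fin n) K) :
    f ∈ Submodule.span K (Set.range fun lam : {lam : Fin n → ℕ // Antitone lam} =>
      U q (lam.1 ∘ Fin.rev)) := by
  classical
  have hanti : ∀ {v : Fin n → ℕ}, Monotone v → Antitone (v ∘ Fin.rev) :=
    fun hv _ _ hab => hv (Fin.rev_le_rev.2 hab)
  have hvv : ∀ v : Fin n → ℕ, v = (v ∘ Fin.rev) ∘ Fin.rev := fun v => by
    rw [Function.comp_assoc, Fin.rev_involutive.comp_self, Function.comp_id]
  set b := basisU (n := n) hq0 hq with hb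
  set S := (b.repr f).support.filter Monotone with hS
  set g := ∑ v ∈ S, b.repr f v • U q v with hg
  have hgmem : g ∈ Submodule.span K (Set.range fun lam : {lam : Fin n → ℕ // Antitone lam} =>
      U q (lam.1 ∘ Fin.rev)) := by
    refine sum_mem fun v hv => Submodule.smul_mem _ _ (Submodule.subset_span ?_)
    have hm := (Finset.mem_filter.1 hv).2
    exact ⟨⟨v ∘ Fin.rev, hanti hm⟩, congrArg (U q) (hvv v).symm⟩
  have hgs : g ∈ symmetricSubalgebra (Fin n) K := by
    refine sum_mem fun v hv => Subalgebra.smul_mem _ ?_ _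
    have hm := (Finset.mem_filter.1 hv).2
    rw [hvv v]
    exact U_comp_rev_mem hq0 hq (hanti hm)
  suffices f - g = 0 by rwa [sub_eq_zero.1 this]
  have hz : ∀ u, form q n (f - g) (UHat q u) = 0 := by
    refine form_UHat_eq_zero hq0 hq (sub_mem hf hgs) fun μ hμ => ?_
    have hrepr : b.repr f (μ ∘ Fin.rev) = form q n f (UHat q μ) := by
      rw [hb, basisU_repr, ← hvv]
    have e : form q n g (UHat q μ) = ∑ v ∈ S, if v = μ ∘ Fin.rev then b.repr f v else 0 := by
      rw [hg, map_sum, LinearMap.sum_apply]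
      refine Finset.sum_congr rfl fun v _ => ?_
      rw [map_smul, LinearMap.smul_apply, form_U_UHat hq0 hq, smul_eq_mul, mul_ite, mul_one,
        mul_zero]
    rw [map_sub, LinearMap.sub_apply, e, Finset.sum_ite_eq', ← hrepr]
    split_ifs with hmem
    · exact sub_self _
    · rw [sub_zero]
      by_contra hne
      exact hmem (Finset.mem_filter.2 ⟨Finsupp.mem_support_iff.2 hne, antitone_comp_rev hμ⟩)
  refine b.repr.map_eq_zero_iff.1 (Finsupp.ext fun v => ?_)
  rw [hb, basisU_repr, hz, Finsupp.zero_apply]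

/-- The basis of the Hall-Littlewood polynomials. -/
def basisHallLittlewood (hq0 : q ≠ 0) (hq : ∀ k, 0 < k → q ^ k ≠ 1) :
    Module.Basis {lam : Fin n → ℕ // Antitone lam} K (symmetricSubalgebra (Fin n) K) :=
  Module.Basis.mk
    (v := fun lam => ⟨U q (lam.1 ∘ Fin.rev), U_comp_rev_mem hq0 hq lam.2⟩)
    (by
      refine LinearIndependent.of_comp (symmetricSubalgebra (Fin n) K).val.toLinearMap ?_
      exact (linearIndependent_U hq0 hq).comp
        (fun lam : {lam : Fin n → ℕ // Antitone lam} => lam.1 ∘ Fin.rev)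
        fun a b hab => Subtype.ext (Fin.rev_surjective.injective_comp_right hab))
    (by
      rintro ⟨f, hf⟩ -
      have h := mem_span_U_comp_rev hq0 hq hf
      have e : (Set.range fun lam : {lam : Fin n → ℕ // Antitone lam} => U q (lam.1 ∘ Fin.rev)) =
          (symmetricSubalgebra (Fin n) K).val.toLinearMap '' Set.range
            (fun lam : {lam : Fin n → ℕ // Antitone lam} =>
              ⟨U q (lam.1 ∘ Fin.rev), U_comp_rev_mem hq0 hq lam.2⟩) := by
        rw [← Set.range_comp]
        rfl
      rw [e, Submodule.span_image] at h
      obtain ⟨x, hx, hxf⟩ := h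
      rwa [show x = ⟨f, hf⟩ from Subtype.ext hxf] at hx)

theorem basisHallLittlewood_apply (hq0 : q ≠ 0) (hq : ∀ k, 0 < k → q ^ k ≠ 1)
    (lam : {lam : Fin n → ℕ // Antitone lam}) :
    (basisHallLittlewood hq0 hq lam : MvPolynomial (Fin n) K) = U q (lam.1 ∘ Fin.rev) :=
  congrArg Subtype.val (Module.Basis.mk_apply _ _ lam)

end HallLittlewood

/-! ### The theorem over the field `F(q)` -/

theorem ratFunc_X_pow_ne_one (F : Type*) [Field F] (k : ℕ) (hk : 0 < k) :
    (RatFunc.X : RatFunc F) ^ k ≠ 1 := by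
  rw [← RatFunc.algebraMap_X, ← map_pow, ← map_one (algebraMap (Polynomial F) (RatFunc F))]
  intro h
  have := congrArg Polynomial.natDegree (RatFunc.algebraMap_injective F h)
  rw [Polynomial.natDegree_X_pow, Polynomial.natDegree_one] at this
  omega

end

end QKey

theorem mainTheorem1 (F : Type*) [Field F] (n : ℕ) :
    -- the recursions that define the Yang-Baxter elements are consistent
    QKey.IsYangBaxter (RatFunc.X : RatFunc F) (QKey.params RatFunc.X n)
      (QKey.yangBaxter RatFunc.X (QKey.params RatFunc.X n)) ∧
    QKey.IsYangBaxter (RatFunc.X : RatFunc F) (QKey.paramsRev RatFunc.X n)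
      (QKey.yangBaxter RatFunc.X (QKey.paramsRev RatFunc.X n)) ∧
    -- both families are bases of the polynomial ring
    (∃ b : Module.Basis (Fin n → ℕ) (RatFunc F) (MvPolynomial (Fin n) (RatFunc F)),
      ∀ v, b v = QKey.U RatFunc.X v) ∧
    (∃ b : Module.Basis (Fin n → ℕ) (RatFunc F) (MvPolynomial (Fin n) (RatFunc F)),
      ∀ v, b v = QKey.UHat RatFunc.X v) ∧
    -- they are adjoint
    (∀ u v : Fin n → ℕ,
      QKey.form (RatFunc.X : RatFunc F) n (QKey.U RatFunc.X v)
        (QKey.UHat RatFunc.X (u ∘ Fin.rev)) = if v = u then 1 else 0) ∧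
    -- Hall-Littlewood polynomials are the basis dual to the dominant monomials
    (∃ P : Module.Basis {lam : Fin n → ℕ // Antitone lam} (RatFunc F)
        (MvPolynomial.symmetricSubalgebra (Fin n) (RatFunc F)),
      (∀ lam, algebraMap (MvPolynomial (Fin n) (RatFunc F))
          (FractionRing (MvPolynomial (Fin n) (RatFunc F)))
          (P lam : MvPolynomial (Fin n) (RatFunc F)) =
            QKey.hallLittlewood RatFunc.X lam.1) ∧
      ∀ lam mu : {lam : Fin n → ℕ // Antitone lam},
        QKey.form (RatFunc.X : RatFunc F) n
          (P lam : MvPolynomial (Fin n) (RatFunc F)) (QKey.mono (RatFunc F) mu.1) =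
            if lam = mu then 1 else 0) := by
  have hq0 : (RatFunc.X : RatFunc F) ≠ 0 := RatFunc.X_ne_zero
  have hq := QKey.ratFunc_X_pow_ne_one F
  refine ⟨QKey.isYangBaxter_params hq0 hq, QKey.isYangBaxter_paramsRev hq0 hq,
    ⟨QKey.basisU hq0 hq, QKey.basisU_apply hq0 hq⟩,
    ⟨QKey.basisUHat hq0 hq, QKey.basisUHat_apply hq0 hq⟩, QKey.form_U_UHat_rev hq0 hq,
    QKey.basisHallLittlewood hq0 hq, fun lam => ?_, fun lam mu => ?_⟩
  · rw [QKey.basisHallLittlewood_apply, QKey.algebraMap_U_comp_rev hq0 hq lam.2]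
  · rw [QKey.basisHallLittlewood_apply, ← QKey.UHat_of_antitone mu.2, QKey.form_U_UHat hq0 hq]
    refine if_congr ⟨fun h => ?_, fun h => by rw [h]⟩ rfl rfl
    exact Subtype.ext (Fin.rev_surjective.injective_comp_right h)
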